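/- Let $X$ be a connected compact Riemann surface of genus $g$, $\alpha_1,\dots,\alpha_g$ a basis of the space $\Omega^1$ of holomorphic differentials, orthonormal for $\frac i2\int_X\alpha\wedge\overline\beta$, $S^*\subset X$ a finite set, and $\mu$ an admissible current, i.e. a smooth volume form of total mass $1$ or a delta current $\delta_a$, $a\in X$. Let $G$ be a Green function of $\mu$: a real solution on $X\times X$, smooth outside of the diagonal (and of $\{a\}\times X\cup X\times\{a\}$ if $\mu=\delta_a$), with logarithmic singularities there, of $$\frac1{2\pi i}\overline\partial\partial G=\delta_\Delta-\Bigl(p_1^*\mu+p_2^*\mu-\frac i2\sum_k(p_1^*\alpha_k\wedge p_2^*\overline\alpha_k+p_2^*\alpha_k\wedge p_1^*\overline\alpha_k)\Bigr);$$ its value on the singular divisor is set to $0$. For functions $\varphi_0,\dots,\varphi_r$ put $$\omega_r(\varphi_0,\dots,\varphi_r)=\frac1{(r+1)!}\mathrm{Alt}_{r+1}\sum_{k=0}^r(-1)^k\varphi_0\,\partial\varphi_1\wedge\dots\wedge\partial\varphi_k\wedge\overline\partial\varphi_{k+1}\wedge\dots\wedge\overline\partial\varphi_r.$$ Let $V^\vee=\mathbb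 C[S^*]\oplus(\Omega^1\oplus\overline{\Omega^1})$. Let $T$ be a plane trivalent tree with $m+1$ ends, decorated clockwise by $v_0,\dots,v_m$, each $v_i$ being a generator $\{s\}$, $s\in S^*$, or a one-form in $\Omega^1\oplus\overline{\Omega^1}$. An end decorated by $\{s\}$ is placed at the point $s$. To an edge $E$ whose ends are internal vertices or $\{s\}$-decorated assign the function $G_E=G(x,y)$ of its two end points; to an edge with an end decorated by a one-form $\eta$ assign the form $G_E=\eta$ on the copy of $X$ of its internal vertex. Put $$\kappa_T=\mathrm{sgn}(E_0\wedge\dots\wedge E_{2m-2})\;\omega_r(G_{E_0},\dots,G_{E_r})\wedge G_{E_{r+1}}\wedge\dots\wedge G_{E_{2m-2}},$$ where $E_0,\dots,E_r$ are the edges of the first kind, $E_{r+1},\dots,E_{2m-2}$ those of the second kind, and the sign compares this ordering with the canonical (clockwise) orientation of the plane tree. (If there is no edge of the first kind, or if a tree with a single edge has an end decorated by a one-form, put $\kappa_T=0$.) The Hodge correlator of the cyclic word is $$\mathrm{Cor}_{\mathcal H}\,\mathcal C(v_0\otimes\dots\otimes v_m)=\sum_T\int_{X^{\{\text{internal vertices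 of }T\}}}\kappa_T,$$ the sum being over all plane trivalent trees decorated by the word. It is extended by linearity, from the words in the $\{s\}$, $s\in S^*$, and the elements of a basis of $\Omega^1\oplus\overline{\Omega^1}$, to the cyclic envelope $\mathcal C^\vee_{X,S^*}=A^+/[A^+,A^+]$ of the tensor algebra $A=T(V^\vee)$, where $A^+$ is the augmentation ideal. Let $\mathcal{CL}ie^\vee_{X,S^*}$ be the quotient of $\mathcal C^\vee_{X,S^*}$ by the subspace generated by all elements $\sum_{\sigma\in\Sigma_{p,q}}\mathcal C(v_0\otimes v_{\sigma(1)}\otimes\dots\otimes v_{\sigma(p+q)})$, $v_i\in V^\vee$, $p,q\ge1$; here $\Sigma_{p,q}$ is the set of $(p,q)$-shuffles, i.e. of the permutations $\sigma$ such that $1,\dots,p$ occur in this order in the sequence $\sigma(1),\dots,\sigma(p+q)$, and so do $p+1,\dots,p+q$. Then $\mathrm{Cor}_{\mathcal H}$ is a well defined linear map $\mathcal C^\vee_{X,S^*}\to\mathbb C$, and for all $p,q\ge1$ and $v_0,\dots,v_{p+q}\in V^\vee$ $$\sum_{\sigma\in\Sigma_{p,q}}\mathrm{Cor}_{\mathcal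 H}\,\mathcal C(v_0\otimes v_{\sigma(1)}\otimes\dots\otimes v_{\sigma(p+q)})=0;$$ the same relation holds for the tree sums themselves when each $v_i$ is a point of $S^*$ or an arbitrary one-form in $\Omega^1\oplus\overline{\Omega^1}$. Hence $\mathrm{Cor}_{\mathcal H}$ descends to a unique linear map $\mathcal{CL}ie^\vee_{X,S^*}\to\mathbb C$. -/

import Mathlib

open MeasureTheory
open scoped Manifold ContDiff

noncomputable section

namespace HodgeCorrelator

/-! ### Charts, one-forms and integration on a compact Riemann surface -/

section Surface

variable (X : Type*) [TopologicalSpace X] [ChartedSpace ℂ X]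

/-- The charts of the atlas of `X`. -/
abbrev Chart : Type _ := ↥(atlas ℂ X)

variable {X} in
/-- The coordinate change from the chart `e` to the chart `e'`. -/
def transition (e e' : Chart X) (z : ℂ) : ℂ := e'.1 (e.1.symm z)

/-- Holomorphic differentials `Ω¹(X)`: in every chart `e` the differential is `f e z dz`, the
coefficient `f e` being holomorphic on the image of the chart (and, by convention, `0` outside of
it), with the usual transformation law under coordinate changes. -/
def holForms : Submodule ℂ (Chart X → ℂ → ℂ) where
  carrier := {f | (∀ e, DifferentiableOn ℂ (f e) e.1.target) ∧
    (∀ e, ∀ z ∉ e.1.target, f e z = 0) ∧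
    ∀ e e', ∀ z ∈ e.1.target, e.1.symm z ∈ e'.1.source →
      f e z = f e' (transition e e' z) * deriv (transition e e') z}
  zero_mem' := ⟨fun _ => differentiableOn_const 0, fun _ _ _ => rfl, fun _ _ _ _ _ => by simp⟩
  add_mem' := by
    rintro f g ⟨hf, hf0, hf'⟩ ⟨hg, hg0, hg'⟩
    refine ⟨fun e => (hf e).add (hg e), fun e z hz => ?_, fun e e' z hz hz' => ?_⟩
    · simp [hf0 e z hz, hg0 e z hz]
    · simp [hf' e e' z hz hz', hg' e e' z hz hz', add_mul]
  smul_mem' := by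
    rintro c f ⟨hf, hf0, hf'⟩
    refine ⟨fun e => (hf e).const_smul c, fun e z hz => ?_, fun e e' z hz hz' => ?_⟩
    · simp [hf0 e z hz]
    · simp [hf' e e' z hz hz', mul_assoc]

/-- Antiholomorphic differentials, i.e. the complex conjugates of the holomorphic ones: in every
chart `e` the differential is `f e z dz̄`. -/
def antiholForms : Submodule ℂ (Chart X → ℂ → ℂ) where
  carrier := {f | (fun e z => (starRingEnd ℂ) (f e z)) ∈ holForms X}
  zero_mem' := by
    have : (fun (e : Chart X) (z : ℂ) => (starRingEnd ℂ) ((0 : Chart X → ℂ → ℂ) e z)) = 0 := by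
      ext; simp
    simp only [Set.mem_ofPred_eq, this, zero_mem]
  add_mem' := by
    intro f g hf hg
    have : (fun (e : Chart X) (z : ℂ) => (starRingEnd ℂ) ((f + g) e z)) =
        (fun e z => (starRingEnd ℂ) (f e z)) + fun e z => (starRingEnd ℂ) (g e z) := by
      ext; simp
    simp only [Set.mem_ofPred_eq, this]
    exact add_mem hf hg
  smul_mem' := by
    intro c f hf
    have : (fun (e : Chart X) (z : ℂ) => (starRingEnd ℂ) ((c • f) e z)) =
        (starRingEnd ℂ) c • fun e z => (starRingEnd ℂ) (f e z) := by
      ext; simp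
    simp only [Set.mem_ofPred_eq, this]
    exact Submodule.smul_mem _ _ hf

/-- The space `Ω¹(X) ⊕ Ω̄¹(X) = H¹(X, ℂ)` of harmonic one-forms. -/
abbrev OneForms : Type _ := holForms X × antiholForms X

variable [CompactSpace X] [MeasurableSpace X] [BorelSpace X]

theorem exists_chartSel : ∃ c : X → Chart X, (∀ x, x ∈ (c x).1.source) ∧
    (Set.range c).Finite ∧ ∀ e, MeasurableSet (c ⁻¹' {e}) := by
  classical
  obtain ⟨t, ht⟩ := isCompact_univ.elim_finite_subcover
    (fun x : X => (chartAt ℂ x).source) (fun x => (chartAt ℂ x).open_source)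
    (fun x _ => Set.mem_iUnion.2 ⟨x, mem_chart_source ℂ x⟩)
  set l := t.toList with hl
  have hcov : ∀ x : X, ∃ n : ℕ, ∃ h : n < l.length, x ∈ (chartAt ℂ l[n]).source := by
    intro x
    obtain ⟨y, hy, hxy⟩ := Set.mem_iUnion₂.1 (ht (Set.mem_univ x))
    obtain ⟨n, hn, rfl⟩ := List.getElem_of_mem (Finset.mem_toList.2 hy)
    exact ⟨n, hn, hxy⟩
  let N : X → ℕ := fun x => Nat.find (hcov x)
  have hN : ∀ x, N x < l.length := fun x => (Nat.find_spec (hcov x)).1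
  let d : Fin l.length → Chart X := fun n => ⟨chartAt ℂ l[n.1], chart_mem_atlas ℂ _⟩
  have hopen : ∀ n : ℕ, MeasurableSet
      {x : X | ∃ h : n < l.length, x ∈ (chartAt ℂ l[n]).source} := by
    intro n
    by_cases h : n < l.length
    · simpa [h] using (chartAt ℂ l[n]).open_source.measurableSet
    · simp [h]
  have hNm : Measurable N := measurable_find hcov hopen
  refine ⟨fun x => d ⟨N x, hN x⟩, fun x => (Nat.find_spec (hcov x)).2, ?_, fun e => ?_⟩
  · exact (Set.finite_range d).subset (by rintro _ ⟨x, rfl⟩; exact ⟨_, rfl⟩)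
  · have : (fun x => d ⟨N x, hN x⟩) ⁻¹' {e} = N ⁻¹' {n | ∃ h : n < l.length, d ⟨n, h⟩ = e} := by
      ext x
      simp [hN x]
    rw [this]
    exact hNm trivial

/-- A choice, for every point `x` of `X`, of a chart around `x`, taking finitely many values, each
of them on a Borel set. The integrals below do not depend on it. -/
def chartSel : X → Chart X := (exists_chartSel X).choose

/-- The measure on `X` which is Lebesgue measure `dx dy` in the chart `e` on the Borel set where
`e` is selected. A top degree form on a power of `X` is integrated by integrating its coefficients
in the selected charts against the powers of this measure. -/
def chartMeasure : Measure X :=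
  ∑ e ∈ (exists_chartSel X).choose_spec.2.1.toFinset,
    ((volume : Measure ℂ).restrict
      (e.1.target ∩ e.1.symm ⁻¹' (chartSel X ⁻¹' {e}))).map e.1.symm

variable {X} in
/-- The coefficient at `x` of a tensor `f`, in the chart selected at `x`. -/
def coeffAt {R : Type*} (f : Chart X → ℂ → R) (x : X) : R := f (chartSel X x) ((chartSel X x).1 x)

variable {X} in
/-- Orthonormality for `⟨α, β⟩ = (i/2) ∫_X α ∧ β̄`, where `(i/2) dz ∧ dz̄ = dx ∧ dy`. -/
def IsOrthonormal {g : ℕ} (α : Fin g → holForms X) : Prop :=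
  ∀ k l, ∫ x, coeffAt (α k).1 x * (starRingEnd ℂ) (coeffAt (α l).1 x) ∂(chartMeasure X) =
    if k = l then 1 else 0

/-- A smooth volume form of total mass one on `X`, written `dens e z dx ∧ dy` in the chart `e`. -/
structure VolumeForm where
  /-- the density in a chart -/
  dens : Chart X → ℂ → ℝ
  smooth : ∀ e, ContDiffOn ℝ ∞ (dens e) e.1.target
  pos : ∀ e, ∀ z ∈ e.1.target, 0 < dens e z
  trans : ∀ e e', ∀ z ∈ e.1.target, e.1.symm z ∈ e'.1.source →
    dens e z = dens e' (transition e e' z) * ‖deriv (transition e e') z‖ ^ 2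
  mass : ∫ x, coeffAt dens x ∂(chartMeasure X) = 1

/-- Admissible currents: smooth volume forms of mass one and delta currents of points. -/
inductive AdmissibleCurrent
  | vol (m : VolumeForm X)
  | delta (a : X)

variable {X}

/-- The density of `μ` outside of its singular support. -/
def AdmissibleCurrent.dens : AdmissibleCurrent X → Chart X → ℂ → ℝ
  | .vol m => m.dens
  | .delta _ => 0

/-- The singular divisor of the Green function of `μ`: the diagonal, together with
`{a} × X ∪ X × {a}` when `μ = δ_a`. -/
def AdmissibleCurrent.divisor : AdmissibleCurrent X → Set (X × X)
  | .vol _ => {p | p.1 = p.2}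
  | .delta a => {p | p.1 = p.2 ∨ p.1 = a ∨ p.2 = a}

open Classical in
/-- The logarithmic singularity of the Green function of `μ` near the point `(x₀, y₀)`. -/
def AdmissibleCurrent.logSing (μ : AdmissibleCurrent X) (x₀ y₀ x y : X) : ℝ :=
  (if x₀ = y₀ then Real.log (‖chartAt ℂ x₀ x - chartAt ℂ x₀ y‖ ^ 2) else 0) -
  match μ with
  | .vol _ => 0
  | .delta a =>
    (if x₀ = a then Real.log (‖chartAt ℂ a x - chartAt ℂ a a‖ ^ 2) else 0) +
    (if y₀ = a then Real.log (‖chartAt ℂ a y - chartAt ℂ a a‖ ^ 2) else 0)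

end Surface

/-! ### Differential forms in coordinates on a power `X ^ V` -/

section Forms

variable (V : Type*)

/-- Complex valued (real linear) covectors on `ℂ ^ V`. -/
abbrev Cov : Type _ := (V → ℂ) →ₗ[ℝ] ℂ

/-- Complex valued exterior forms on `ℂ ^ V`. -/
abbrev ExtForm : Type _ := ExteriorAlgebra ℂ (Cov V)

variable {V} [Fintype V]

/-- Multiplication by `i` on tangent vectors. -/
def mulI : (V → ℂ) →ₗ[ℝ] (V → ℂ) := (LinearMap.lsmul ℂ (V → ℂ) Complex.I).restrictScalars ℝ

/-- `∂f` at `z`. -/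
def del (f : (V → ℂ) → ℂ) (z : V → ℂ) : Cov V :=
  (1 / 2 : ℂ) • ((fderiv ℝ f z).toLinearMap -
    Complex.I • ((fderiv ℝ f z).toLinearMap ∘ₗ mulI))

/-- `∂̄f` at `z`. -/
def delbar (f : (V → ℂ) → ℂ) (z : V → ℂ) : Cov V :=
  (1 / 2 : ℂ) • ((fderiv ℝ f z).toLinearMap +
    Complex.I • ((fderiv ℝ f z).toLinearMap ∘ₗ mulI))

/-- The form `ω_m(φ₀, …, φ_m)` at `z`:
`1/(m+1)! Alt (∑_{k=0}^m (-1)^k φ₀ ∂φ₁ ∧ … ∧ ∂φ_k ∧ ∂̄φ_{k+1} ∧ … ∧ ∂̄φ_m)`. -/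
def omegaForm {m : ℕ} (φ : Fin (m + 1) → (V → ℂ) → ℂ) (z : V → ℂ) : ExtForm V :=
  (1 / ((m + 1).factorial : ℂ)) • ∑ σ : Equiv.Perm (Fin (m + 1)),
    ((Equiv.Perm.sign σ : ℤ) : ℂ) • ∑ k ∈ Finset.range (m + 1),
      ((-1 : ℂ) ^ k * φ (σ 0) z) • (List.ofFn fun j : Fin m =>
        ExteriorAlgebra.ι ℂ
          (if (j : ℕ) < k then del (φ (σ j.succ)) z else delbar (φ (σ j.succ)) z)).prod

/-- `ω_r(φ₀, …, φ_r)` for a list of functions (for the empty list there is no such form, and the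
value is `0`). -/
def omegaList (z : V → ℂ) : List ((V → ℂ) → ℂ) → ExtForm V
  | [] => 0
  | f :: fs => omegaForm (m := fs.length) (fun i => (f :: fs).get i) z

open Classical in
/-- The positively oriented real frame `e₁, i e₁, e₂, i e₂, …` of `ℂ ^ V`. The orientation does not
depend on the enumeration of `V`. -/
def frame (k : Fin (Fintype.card V * 2)) : V → ℂ :=
  Pi.single ((Fintype.equivFin V).symm (finProdFinEquiv.symm k).1)
    (if (finProdFinEquiv.symm k).2 = 0 then 1 else Complex.I)

/-- The values of a covector on the frame. -/
def evalFrame : Cov V →ₗ[ℂ] (Fin (Fintype.card V * 2) → ℂ) where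
  toFun θ k := θ (frame k)
  map_add' _ _ := rfl
  map_smul' _ _ := rfl

/-- The coefficient of the top degree part of a form with respect to `dx₁ ∧ dy₁ ∧ dx₂ ∧ dy₂ ∧ …`,
i.e. its value on the positively oriented frame. -/
def topCoeff : ExtForm V →ₗ[ℂ] ℂ :=
  ExteriorAlgebra.liftAlternating
    (Pi.single (Fintype.card V * 2) (Matrix.detRowAlternating.compLinearMap evalFrame))

end Forms

/-! ### Green functions -/

section Green

variable {X : Type*} [TopologicalSpace X] [ChartedSpace ℂ X]

/-- The expression of a real function on `X ^ V` in local coordinates. -/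
def localRep {V : Type*} (F : (V → X) → ℝ) (c : V → Chart X) (z : V → ℂ) : ℂ :=
  (F fun v => (c v).1.symm (z v) : ℝ)

/-- `∂f/∂z_j`. -/
def dz (j : Fin 2) (f : (Fin 2 → ℂ) → ℂ) (z : Fin 2 → ℂ) : ℂ := del f z (Pi.single j 1)

/-- `∂f/∂z̄_j`. -/
def dzbar (j : Fin 2) (f : (Fin 2 → ℂ) → ℂ) (z : Fin 2 → ℂ) : ℂ := delbar f z (Pi.single j 1)

variable [CompactSpace X] [MeasurableSpace X] [BorelSpace X]

/-- `G` is a Green function of the admissible current `μ`, i.e. a solution of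
`(2πi)⁻¹ ∂̄∂ G = δ_Δ - (p₁^*μ + p₂^*μ - (i/2) ∑_k (p₁^*α_k ∧ p₂^*ᾱ_k + p₂^*α_k ∧ p₁^*ᾱ_k))`
on `X × X`: it is smooth outside of the singular divisor, has the logarithmic singularities along
the divisor which produce the delta currents on the right hand side (`(2πi)⁻¹ ∂̄∂ log |t|²` is the
delta current of `t = 0`), and satisfies the equation outside of the divisor. The four components
of the equation are the coefficients of `dz̄₀ ∧ dz₀`, `dz̄₁ ∧ dz₁`, `dz̄₁ ∧ dz₀`, `dz̄₀ ∧ dz₁`.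
On the divisor the value of `G` is set to `0`. -/
structure IsGreenFunction (μ : AdmissibleCurrent X) {g : ℕ} (α : Fin g → holForms X)
    (G : X → X → ℝ) : Prop where
  eq_zero : ∀ p ∈ μ.divisor, G p.1 p.2 = 0
  local_form : ∀ x₀ y₀ : X, ∃ h : ℂ × ℂ → ℝ,
    ContDiffAt ℝ ∞ h (chartAt ℂ x₀ x₀, chartAt ℂ y₀ y₀) ∧
    ∀ᶠ p in nhds (x₀, y₀), p ∉ μ.divisor →
      G p.1 p.2 = μ.logSing x₀ y₀ p.1 p.2 + h (chartAt ℂ x₀ p.1, chartAt ℂ y₀ p.2)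
  equation : ∀ (c : Fin 2 → Chart X) (z : Fin 2 → ℂ), (∀ j, z j ∈ (c j).1.target) →
    ((c 0).1.symm (z 0), (c 1).1.symm (z 1)) ∉ μ.divisor →
    let f := localRep (fun x : Fin 2 → X => G (x 0) (x 1)) c
    dzbar 0 (dz 0 f) z = -Real.pi * μ.dens (c 0) (z 0) ∧
    dzbar 1 (dz 1 f) z = -Real.pi * μ.dens (c 1) (z 1) ∧
    dzbar 1 (dz 0 f) z =
      Real.pi * ∑ k, (α k).1 (c 0) (z 0) * (starRingEnd ℂ) ((α k).1 (c 1) (z 1)) ∧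
    dzbar 0 (dz 1 f) z =
      Real.pi * ∑ k, (α k).1 (c 1) (z 1) * (starRingEnd ℂ) ((α k).1 (c 0) (z 0))

end Green

/-! ### Decorated plane trivalent trees -/

section Trees

/-- A plane trivalent tree with one distinguished end (the root), the other ends being decorated
by elements of `L`: the edge at the root ends either in another end of the tree, or in an internal
vertex, from which a left and a right subtree grow (the three edges at the vertex being, clockwise:
the edge towards the root, the left one, the right one). -/
inductive PlaneTree (L : Type*)
  | leaf (l : L) : PlaneTree L
  | node (left right : PlaneTree L) : PlaneTree L

variable {L : Type*}

/-- The decorations of the ends, in clockwise order starting from (and omitting) the root. -/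
def PlaneTree.ends : PlaneTree L → List L
  | .leaf l => [l]
  | .node s t => s.ends ++ t.ends

/-- There are finitely many plane trivalent trees with given decorations of the ends. -/
theorem PlaneTree.finite_ends_eq (w : List L) : Finite {T : PlaneTree L // T.ends = w} := by
  have hne : ∀ T : PlaneTree L, T.ends ≠ [] := by
    intro T; induction T <;> simp_all [PlaneTree.ends]
  induction h : w.length using Nat.strong_induction_on generalizing w with
  | _ n ih =>
  subst h
  have : {T : PlaneTree L | T.ends = w} ⊆ (⋃ l ∈ {l | l ∈ w}, {PlaneTree.leaf l}) ∪
      ⋃ i ∈ Finset.Ioo 0 w.length,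
        Set.image2 PlaneTree.node {T | T.ends = w.take i} {T | T.ends = w.drop i} := by
    rintro (l | ⟨s, t⟩) h
    · left; simp [PlaneTree.ends] at h; simp [← h]
    · right
      have h' : s.ends ++ t.ends = w := h
      have h1 := List.length_pos_of_ne_nil (hne s)
      have h2 := List.length_pos_of_ne_nil (hne t)
      simp only [Set.mem_iUnion]
      refine ⟨s.ends.length, by simp [← h']; omega, s, by simp [← h'], t, by simp [← h'], rfl⟩
  refine (Set.Finite.subset ?_ this : Set.Finite _)
  refine Set.Finite.union
    (Set.Finite.biUnion (List.finite_toSet w) fun _ _ => Set.finite_singleton _) ?_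
  refine Set.Finite.biUnion (Finset.finite_toSet _) fun i hi => ?_
  simp at hi
  exact Set.Finite.image2 _ (ih _ (by simp; omega) _ rfl) (ih _ (by simp; omega) _ rfl)

/-- The internal vertices. -/
def PlaneTree.Vert : PlaneTree L → Type
  | .leaf _ => Empty
  | .node s t => Option (s.Vert ⊕ t.Vert)

instance PlaneTree.instFiniteVert : (t : PlaneTree L) → Finite t.Vert
  | .leaf _ => inferInstanceAs (Finite Empty)
  | .node s t =>
    have := PlaneTree.instFiniteVert s
    have := PlaneTree.instFiniteVert t
    inferInstanceAs (Finite (Option (s.Vert ⊕ t.Vert)))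

instance PlaneTree.instFintypeVert (t : PlaneTree L) : Fintype t.Vert := Fintype.ofFinite _

/-- The edges, given by their two end points; an end point is an internal vertex, or an external
vertex with its decoration. Here `i` names the internal vertices and `p` is the root. The edges are
listed in the order `E₁ ∧ E₂ ∧ …` of the canonical orientation of the plane tree: it is the one
which for a single vertex is the clockwise order of its three edges, and which for the union of two
trees along an edge `E` is `E ∧ A ∧ B`, if `E ∧ A` and `E ∧ B` are the canonical orientations of
the two trees. -/
def PlaneTree.edges {V : Type} : (t : PlaneTree L) → (i : t.Vert → V) → (p : V ⊕ L) →
    List ((V ⊕ L) × (V ⊕ L))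
  | .leaf l, _, p => [(p, .inr l)]
  | .node s t, i, p =>
    (p, .inl (i none)) ::
      (s.edges (fun v => i (some (.inl v))) (.inl (i none)) ++
        t.edges (fun v => i (some (.inr v))) (.inl (i none)))

end Trees

/-! ### Hodge correlators -/

section Correlators

variable {X : Type*} [TopologicalSpace X] [ChartedSpace ℂ X]

/-- The decorations: points of `S` and one-forms. -/
abbrev Letter (S : Finset X) : Type _ := S ⊕ OneForms X

/-- What an edge with given end points contributes: either a function on `X ^ V`, namely the Green
function of its end points; or, if one of its ends is decorated by a one-form (a special edge), this
one-form on the copy of `X` which corresponds to the other end point. A tree which consists of just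
one edge contributes `0` unless both its ends are decorated by points. -/
def edgeTerm {S : Finset X} (G : X → X → ℝ) {V : Type} :
    (V ⊕ Letter S) × (V ⊕ Letter S) → ((V → X) → ℝ) ⊕ (V × OneForms X)
  | (.inl u, .inl v) => .inl fun x => G (x u) (x v)
  | (.inl u, .inr (.inl s)) => .inl fun x => G (x u) s
  | (.inr (.inl s), .inl v) => .inl fun x => G s (x v)
  | (.inr (.inl s), .inr (.inl s')) => .inl fun _ => G s s'
  | (.inl u, .inr (.inr η)) => .inr (u, η)
  | (.inr (.inr η), .inl v) => .inr (v, η)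
  | (.inr (.inl _), .inr (.inr _)) => .inl fun _ => 0
  | (.inr (.inr _), .inr (.inl _)) => .inl fun _ => 0
  | (.inr (.inr _), .inr (.inr _)) => .inl fun _ => 0

/-- The one-form `η` on the `v`-th copy of `X`, pulled back to `X ^ V`, in the coordinates `c`. -/
def oneFormAt {V : Type} (c : V → Chart X) (z : V → ℂ) (v : V) (η : OneForms X) : Cov V where
  toFun w := η.1.1 (c v) (z v) * w v + η.2.1 (c v) (z v) * (starRingEnd ℂ) (w v)
  map_add' w w' := by simp; ring
  map_smul' r w := by simp; ring

/-- The number of pairs in which an element of the second kind precedes one of the first kind. -/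
def inversions {A B : Type*} : List (A ⊕ B) → ℕ
  | [] => 0
  | .inl _ :: l => inversions l
  | .inr _ :: l => (l.filterMap Sum.getLeft?).length + inversions l

/-- The form `sgn · ω_r(G_{E_0}, …, G_{E_r}) ∧ G_{E_{r+1}} ∧ …` on `X ^ V`, in the coordinates `c`.
The edges are given in an order which represents the canonical orientation of the tree; they are
reordered so that the special edges come last, and `sgn` is the sign of the reordering. -/
def kappa {V : Type} [Fintype V] (E : List (((V → X) → ℝ) ⊕ (V × OneForms X)))
    (c : V → Chart X) (z : V → ℂ) : ExtForm V :=
  (-1 : ℂ) ^ inversions E •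
    (omegaList z ((E.filterMap Sum.getLeft?).map fun F => localRep F c) *
      ((E.filterMap Sum.getRight?).map fun p =>
        ExteriorAlgebra.ι ℂ (oneFormAt c z p.1 p.2)).prod)

variable [CompactSpace X] [MeasurableSpace X] [BorelSpace X] {S : Finset X}

/-- The integral of `κ_T` over the product of copies of `X` corresponding to the internal vertices
of the plane trivalent tree `T` with root decorated by `l₀`. -/
def treeIntegral (G : X → X → ℝ) (l₀ : Letter S) (T : PlaneTree (Letter S)) : ℂ :=
  ∫ x : T.Vert → X,
    topCoeff (kappa ((T.edges id (.inr l₀)).map (edgeTerm G))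
      (fun v => chartSel X (x v)) (fun v => (chartSel X (x v)).1 (x v)))
    ∂(Measure.pi fun _ => chartMeasure X)

/-- The Hodge correlator of a cyclic word in points of `S` and one-forms: the sum of the tree
integrals over all plane trivalent trees whose ends are decorated, clockwise, by the letters of the
word, the first letter being placed at the root. The sum is finite. -/
def corWord (G : X → X → ℝ) : List (Letter S) → ℂ
  | [] => 0
  | l₀ :: w => ∑ᶠ T : {T : PlaneTree (Letter S) // T.ends = w}, treeIntegral G l₀ T.1

variable (S) in
/-- `V^∨ = ℂ[S] ⊕ (Ω¹ ⊕ Ω̄¹)`. -/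
abbrev VDual : Type _ := (S →₀ ℂ) × OneForms X

/-- The Hodge correlator map as a linear functional on the tensor algebra of `V^∨`: the linear
extension of `corWord` from words in points of `S` and one-forms of a basis `b` of `Ω¹ ⊕ Ω̄¹`. -/
def cor (G : X → X → ℝ) {K : Type*} (b : Module.Basis K ℂ (OneForms X)) :
    TensorAlgebra ℂ (VDual S) →ₗ[ℂ] ℂ :=
  ((Finsupp.basisSingleOne (ι := S) (R := ℂ)).prod b).tensorAlgebra.constr ℂ
    fun w : FreeMonoid (S ⊕ K) => corWord G ((FreeMonoid.toList w).map (Sum.map id b))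

end Correlators

/-! ### Shuffles and the cyclic envelope of the tensor algebra -/

section Cyclic

/-- The `(p, q)`-shuffles: the permutations `σ` of the indices such that in the sequence
`σ(1), …, σ(p+q)` the indices `1, …, p` appear in this order, and so do `p+1, …, p+q`. -/
def shuffles (p q : ℕ) : Finset (Equiv.Perm (Fin (p + q))) :=
  {σ | ∀ i j : Fin (p + q), i < j → ((j : ℕ) < p ∨ p ≤ (i : ℕ)) → σ.symm i < σ.symm j}

/-- The sequence `v₀, v_{σ(1)}, …, v_{σ(n)}`. -/
def permuteTail {W : Type*} {n : ℕ} (v : Fin (n + 1) → W) (σ : Equiv.Perm (Fin n)) :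
    Fin (n + 1) → W :=
  Fin.cons (v 0) fun i => v (σ i).succ

variable (W : Type*) [AddCommGroup W] [Module ℂ W]

/-- The augmentation ideal `T(W)⁺`. -/
def augIdeal : Submodule ℂ (TensorAlgebra ℂ W) :=
  LinearMap.ker (TensorAlgebra.algebraMapInv (R := ℂ) (M := W)).toLinearMap

/-- The subspace of `T(W)⁺` generated by commutators of elements of `T(W)⁺`. -/
def commutators : Submodule ℂ (augIdeal W) :=
  Submodule.span ℂ {c | ∃ x y : augIdeal W, (c : TensorAlgebra ℂ W) = x.1 * y.1 - y.1 * x.1}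

/-- The cyclic envelope `T(W)⁺ / [T(W)⁺, T(W)⁺]`. -/
abbrev CycEnv : Type _ := augIdeal W ⧸ commutators W

variable {W}

/-- The element `v₀ ⊗ … ⊗ v_n` of `T(W)⁺`. -/
def tensorWord {n : ℕ} (v : Fin (n + 1) → W) : augIdeal W :=
  ⟨(List.ofFn fun i => TensorAlgebra.ι ℂ (v i)).prod, by
    simp [augIdeal, List.ofFn_succ, TensorAlgebra.algebraMapInv]⟩

/-- The cyclic word `𝒞(v₀ ⊗ … ⊗ v_n)`. -/
def cycWord {n : ℕ} (v : Fin (n + 1) → W) : CycEnv W := (commutators W).mkQ (tensorWord v)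

variable (W)

/-- The subspace of shuffle relations in the cyclic envelope. -/
def shuffleRelations : Submodule ℂ (CycEnv W) :=
  Submodule.span ℂ {c | ∃ p q : ℕ, 1 ≤ p ∧ 1 ≤ q ∧ ∃ v : Fin (p + q + 1) → W,
    c = ∑ σ ∈ shuffles p q, cycWord (permuteTail v σ)}

/-- The quotient of the cyclic envelope by the shuffle relations. -/
abbrev CLie : Type _ := CycEnv W ⧸ shuffleRelations W

end Cyclic

end HodgeCorrelator

end

/-!
Exchanging the two subtrees at an internal vertex exchanges two blocks of edges, each of odd length,
so the antisymmetry of `ω_r` and of the wedge product makes the integral of the tree change sign.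
In a tree whose ends spell a shuffle of two nonempty words there is a vertex one of whose subtrees
carries only letters of the first word and the other only letters of the second; exchanging them
gives a tree on another shuffle. This is a sign reversing involution, and the shuffle relations
follow.

Cyclic invariance amounts to moving the root of a tree to another end, for which `G` has to be
symmetric. The transpose of a Green function is a Green function of the same current. The difference
of two of them, with one variable fixed, is harmonic off the singular divisor and extends
harmonically across it, hence is constant by the maximum principle. For `G x y - G y x` these
constants are antisymmetric in `x` and `y`, and comparing three generic points shows that they
vanish.
-/

noncomputable section

namespace HodgeCorrelator

/-- `SignedPerm ε l l'`: the list `l'` is obtained from `l` by a permutation of sign `ε`. -/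
inductive SignedPerm {A : Type*} : ℤˣ → List A → List A → Prop
  | nil : SignedPerm 1 [] []
  | cons (a : A) {ε : ℤˣ} {l l' : List A} (h : SignedPerm ε l l') :
      SignedPerm ε (a :: l) (a :: l')
  | swap (a b : A) (l : List A) : SignedPerm (-1) (a :: b :: l) (b :: a :: l)
  | trans {ε ε' : ℤˣ} {l l' l'' : List A} (h : SignedPerm ε l l') (h' : SignedPerm ε' l' l'') :
      SignedPerm (ε * ε') l l''

namespace SignedPerm

variable {A B : Type*} {ε ε' : ℤˣ} {l l' l'' : List A}

theorem refl (l : List A) : SignedPerm 1 l l := by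
  induction l with
  | nil => exact .nil
  | cons a l ih => exact ih.cons a

theorem of_eq (h : SignedPerm ε l l') (hε : ε = ε') : SignedPerm ε' l l' := hε ▸ h

theorem map (f : A → B) (h : SignedPerm ε l l') : SignedPerm ε (l.map f) (l'.map f) := by
  induction h with
  | nil => exact .nil
  | cons a _ ih => exact ih.cons _
  | swap a b l => exact .swap _ _ _
  | trans _ _ ih ih' => exact ih.trans ih'

theorem length_eq (h : SignedPerm ε l l') : l.length = l'.length := by
  induction h <;> simp_all

theorem append_left (r : List A) (h : SignedPerm ε l l') : SignedPerm ε (r ++ l) (r ++ l') := by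
  induction r with
  | nil => exact h
  | cons a r ih => exact ih.cons a

theorem append_right (r : List A) (h : SignedPerm ε l l') : SignedPerm ε (l ++ r) (l' ++ r) := by
  induction h with
  | nil => exact refl r
  | cons a _ ih => exact ih.cons a
  | swap a b l => exact .swap a b _
  | trans _ _ ih ih' => exact ih.trans ih'

theorem cons_append (a : A) (l r : List A) :
    SignedPerm ((-1) ^ l.length) (a :: (l ++ r)) (l ++ a :: r) := by
  induction l with
  | nil => exact refl _
  | cons b l ih =>
    exact ((SignedPerm.swap a b (l ++ r)).trans (ih.cons b)).of_eq (by simp [pow_succ])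

theorem append_comm (l l' : List A) :
    SignedPerm ((-1) ^ (l.length * l'.length)) (l ++ l') (l' ++ l) := by
  induction l with
  | nil => simpa using refl l'
  | cons a l ih =>
    exact ((ih.cons a).trans (cons_append a l' l)).of_eq (by simp [add_mul, pow_add])

theorem exists_perm (h : SignedPerm ε l l') : ∃ (n : ℕ) (f : Fin n → A) (τ : Equiv.Perm (Fin n)),
    l = List.ofFn f ∧ l' = List.ofFn (f ∘ τ) ∧ Equiv.Perm.sign τ = ε := by
  induction h with
  | nil => exact ⟨0, Fin.elim0, 1, by simp⟩
  | cons a _ ih =>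
    obtain ⟨n, f, τ, rfl, rfl, rfl⟩ := ih
    refine ⟨n + 1, Fin.cons a f, Equiv.Perm.decomposeFin.symm (0, τ), by simp, ?_, by simp⟩
    simp [List.ofFn_succ, Function.comp_def]
  | swap a b l =>
    refine ⟨l.length + 2, Fin.cons a (Fin.cons b l.get), Equiv.swap 0 1, ?_, ?_, ?_⟩
    · simp
    · rw [List.ofFn_succ, List.ofFn_succ]
      have : ∀ i : Fin l.length, Equiv.swap (0 : Fin (l.length + 2)) 1 i.succ.succ = i.succ.succ :=
        fun i => Equiv.swap_apply_of_ne_of_ne (Fin.succ_ne_zero _)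
          (fun h => Fin.succ_ne_zero i (Fin.succ_injective _ h))
      simp [this]
    · exact Equiv.Perm.sign_swap (by simp)
  | trans _ _ ih ih' =>
    obtain ⟨n, f, τ, rfl, rfl, rfl⟩ := ih
    obtain ⟨n', f', τ', h, rfl, rfl⟩ := ih'
    obtain rfl : n = n' := by simpa using congrArg List.length h
    obtain rfl := List.ofFn_injective h
    exact ⟨n, f, τ * τ', rfl, rfl, by simp⟩

end SignedPerm

/-! ### Plane trees -/

namespace PlaneTree

variable {L M : Type*}

/-- Change of the decorations. -/
def map (f : L → M) : PlaneTree L → PlaneTree M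
  | .leaf l => .leaf (f l)
  | .node s t => .node (s.map f) (t.map f)

theorem ends_map (f : L → M) (T : PlaneTree L) : (T.map f).ends = T.ends.map f := by
  induction T <;> simp_all [PlaneTree.ends, map]

theorem eq_of_map_eq (f : L → M) (T T' : PlaneTree L) (h : T.map f = T'.map f)
    (he : T.ends = T'.ends) : T = T' := by
  induction T generalizing T' with
  | leaf l =>
    cases T' with
    | leaf l' => simpa [ends] using he
    | node s t => simp [map] at h
  | node s t ihs iht =>
    cases T' with
    | leaf l' => simp [map] at h
    | node s' t' =>
      simp only [map, node.injEq] at h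
      have hl : s.ends.length = s'.ends.length := by
        simpa [ends_map] using congrArg (fun T => T.ends.length) h.1
      obtain ⟨h1, h2⟩ := List.append_inj he hl
      rw [ihs s' h.1 h1, iht t' h.2 h2]

theorem exists_map_eq (f : L → M) (T : PlaneTree M) (w : List L) (h : T.ends = w.map f) :
    ∃ T' : PlaneTree L, T'.ends = w ∧ T'.map f = T := by
  induction T generalizing w with
  | leaf m =>
    match w, h with
    | [l], h => exact ⟨.leaf l, rfl, by simpa [ends, map] using h.symm⟩
  | node s t ihs iht =>
    obtain ⟨w₁, w₂, rfl, h1, h2⟩ := List.map_eq_append_iff.1 h.symm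
    obtain ⟨s', hs, rfl⟩ := ihs w₁ h1.symm
    obtain ⟨t', ht, rfl⟩ := iht w₂ h2.symm
    exact ⟨.node s' t', by simp [ends, hs, ht], rfl⟩

/-- The plane trees with given decorations of the ends. -/
def withEnds (w : List L) : Finset (PlaneTree L) :=
  Set.Finite.toFinset (s := {T | T.ends = w}) (finite_ends_eq w)

theorem mem_withEnds {w : List L} {T : PlaneTree L} : T ∈ withEnds w ↔ T.ends = w :=
  Set.Finite.mem_toFinset _

theorem finsum_ends_eq {R : Type*} [AddCommMonoid R] (F : PlaneTree L → R) (w : List L) :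
    ∑ᶠ T : {T : PlaneTree L // T.ends = w}, F T.1 = ∑ T ∈ withEnds w, F T :=
  (finsum_set_coe_eq_finsum_mem {T : PlaneTree L | T.ends = w}).trans
    (finsum_mem_eq_finite_toFinset_sum F _)

theorem sum_withEnds_map {R : Type*} [AddCommMonoid R] (f : L → M) (F : PlaneTree M → R)
    (w : List L) : ∑ T ∈ withEnds (w.map f), F T = ∑ T ∈ withEnds w, F (T.map f) := by
  symm
  refine Finset.sum_bij (fun T _ => T.map f) ?_ ?_ ?_ (fun _ _ => rfl)
  · intro T hT
    rw [mem_withEnds] at *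
    rw [ends_map, hT]
  · intro T hT T' hT' h
    rw [mem_withEnds] at hT hT'
    exact eq_of_map_eq f T T' h (hT.trans hT'.symm)
  · intro T hT
    obtain ⟨T', h, rfl⟩ := exists_map_eq f T w (mem_withEnds.1 hT)
    exact ⟨T', mem_withEnds.2 h, rfl⟩

/-- `T'` is obtained from `T` by exchanging the two subtrees at one vertex. -/
inductive SwapRel : PlaneTree L → PlaneTree L → Prop
  | swap (s t : PlaneTree L) : SwapRel (.node s t) (.node t s)
  | left {s s' : PlaneTree L} (t : PlaneTree L) (h : SwapRel s s') :
      SwapRel (.node s t) (.node s' t)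
  | right (s : PlaneTree L) {t t' : PlaneTree L} (h : SwapRel t t') :
      SwapRel (.node s t) (.node s t')

theorem SwapRel.map (f : L → M) {T T' : PlaneTree L} (h : SwapRel T T') :
    SwapRel (T.map f) (T'.map f) := by
  induction h with
  | swap s t => exact .swap _ _
  | left t _ ih => exact .left _ ih
  | right s _ ih => exact .right _ ih

section Mixed

variable (c : L → Bool)

/-- Both colours occur among the ends of the tree, the letters being coloured by `c`. -/
def Mixed (T : PlaneTree L) : Prop := ∀ d, T.ends.filter (c · = d) ≠ []

open Classical in
/-- Exchange of the subtrees at the first vertex at which a subtree with ends of one colour meets a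
subtree with ends of the other colour: the sign reversing involution behind the shuffle relations.
On trees with ends of a single colour the value has no meaning. -/
def flip : PlaneTree L → PlaneTree L
  | .leaf l => .leaf l
  | .node s t =>
    if s.Mixed c then .node s.flip t else if t.Mixed c then .node s t.flip else .node t s

variable {c}

theorem not_mixed_leaf (l : L) : ¬ (leaf l).Mixed c := by
  intro h
  have := h (!(c l))
  simp [ends] at this

theorem Mixed.swapRel_flip {T : PlaneTree L} (h : T.Mixed c) : SwapRel T (T.flip c) := by
  induction T with
  | leaf l => exact absurd h (not_mixed_leaf l)
  | node s t ihs iht =>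
    rw [flip]
    split_ifs with hs ht
    · exact .left _ (ihs hs)
    · exact .right _ (iht ht)
    · exact .swap _ _

theorem Mixed.filter_ends_flip {T : PlaneTree L} (h : T.Mixed c) (d : Bool) :
    (T.flip c).ends.filter (c · = d) = T.ends.filter (c · = d) := by
  induction T with
  | leaf l => exact absurd h (not_mixed_leaf l)
  | node s t ihs iht =>
    rw [flip]
    split_ifs with hs ht
    · simp only [ends, List.filter_append, ihs hs]
    · simp only [ends, List.filter_append, iht ht]
    · simp only [Mixed, not_forall, not_not] at hs ht
      obtain ⟨ds, hs⟩ := hs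
      obtain ⟨dt, ht⟩ := ht
      have hne : ds ≠ dt := by
        rintro rfl
        exact h ds (by simp only [ends, List.filter_append, hs, ht, List.append_nil])
      simp only [ends, List.filter_append]
      rcases Bool.eq_or_eq_not d ds with rfl | rfl
      · rw [hs]; simp
      · obtain rfl : dt = !ds := by cases ds <;> cases dt <;> simp_all
        rw [ht]; simp

theorem Mixed.flip {T : PlaneTree L} (h : T.Mixed c) : (T.flip c).Mixed c := by
  intro d
  rw [h.filter_ends_flip]
  exact h d

theorem Mixed.flip_flip {T : PlaneTree L} (h : T.Mixed c) : (T.flip c).flip c = T := by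
  induction T with
  | leaf l => rfl
  | node s t ihs iht =>
    rw [PlaneTree.flip]
    split_ifs with hs ht
    · rw [PlaneTree.flip, if_pos hs.flip, ihs hs]
    · rw [PlaneTree.flip, if_neg hs, if_pos ht.flip, iht ht]
    · rw [PlaneTree.flip, if_neg ht, if_neg hs]

theorem Mixed.flip_ne {T : PlaneTree L} (h : T.Mixed c) : T.flip c ≠ T := by
  induction T with
  | leaf l => exact absurd h (not_mixed_leaf l)
  | node s t ihs iht =>
    rw [PlaneTree.flip]
    split_ifs with hs ht
    · simpa using ihs hs
    · simpa using iht ht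
    · intro heq
      obtain rfl : t = s := (node.inj heq).1
      exact hs fun d hd => h d (by simp [ends, hd])

end Mixed

end PlaneTree

section Shuffles

theorem exists_perm_ofFn_eq {n : ℕ} {w : List (Fin n)} (h : w.Perm (List.finRange n)) :
    ∃ σ : Equiv.Perm (Fin n), List.ofFn σ = w := by
  obtain ⟨f, rfl⟩ : ∃ f : Fin n → Fin n, List.ofFn f = w := by
    have hlen : w.length = n := by simpa using h.length_eq
    exact ⟨w.get ∘ Fin.cast hlen.symm, List.ext_get (by simp [hlen]) (by simp)⟩
  have hinj : Function.Injective f :=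
    List.nodup_ofFn.1 (h.nodup_iff.2 (List.nodup_finRange n))
  exact ⟨Equiv.ofBijective f (Finite.injective_iff_bijective.1 hinj), rfl⟩

theorem perm_of_filter_eq {A D : Type*} [DecidableEq D] {c : A → D} {w w' : List A}
    (h : ∀ d, w.filter (c · = d) = w'.filter (c · = d)) : w.Perm w' := by
  classical
  refine List.perm_iff_count.2 fun a => ?_
  have hcount (u : List A) : u.count a = (u.filter (c · = c a)).count a :=
    (List.count_filter (by simp)).symm
  rw [hcount w, hcount w', h]

theorem filter_ofFn_perm_eq_iff {n : ℕ} (σ : Equiv.Perm (Fin n)) (P : Fin n → Prop)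
    [DecidablePred P] :
    (List.ofFn σ).filter P = (List.finRange n).filter P ↔
      ∀ i j, i < j → P (σ i) → P (σ j) → σ i < σ j := by
  have hsorted : ((List.finRange n).filter P).Pairwise (· < ·) :=
    (List.pairwise_lt_finRange n).filter _
  have hperm : (List.ofFn σ).Perm (List.finRange n) := by
    simpa [List.ofFn_id] using Equiv.Perm.ofFn_comp_perm σ (id : Fin n → Fin n)
  have hpairwise : ((List.ofFn σ).filter P).Pairwise (· < ·) ↔
      ∀ i j, i < j → P (σ i) → P (σ j) → σ i < σ j := by
    simp only [List.pairwise_filter, List.pairwise_ofFn, decide_eq_true_eq]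
  rw [← hpairwise]
  exact ⟨fun h => h ▸ hsorted, fun h => (hperm.filter _).eq_of_pairwise
    (fun _ _ _ _ hab hba => absurd hba hab.not_gt) h hsorted⟩

theorem forall_lt_iff_forall_symm_lt {A D : Type*} [LinearOrder A] (c : A → D)
    (σ : Equiv.Perm A) :
    (∀ i j, i < j → c (σ i) = c (σ j) → σ i < σ j) ↔
      ∀ i j, i < j → c i = c j → σ.symm i < σ.symm j := by
  constructor
  · intro h i j hij hc
    by_contra hlt
    have hji : σ.symm j < σ.symm i := lt_of_le_of_ne (not_lt.1 hlt) (by simpa using hij.ne')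
    exact hij.not_gt (by simpa [hc] using h _ _ hji)
  · intro h i j hij hc
    by_contra hlt
    have hji : σ j < σ i := lt_of_le_of_ne (not_lt.1 hlt) (by simpa using hij.ne')
    exact hij.not_gt (by simpa using h _ _ hji hc.symm)

/-- The colouring of the indices `1, …, p + q` (shifted by one) whose colour classes are the two
blocks `1, …, p` and `p + 1, …, p + q` which a shuffle keeps in order. -/
def inFirstBlock (p : ℕ) {n : ℕ} (i : Fin n) : Bool := (i : ℕ) < p

theorem mem_shuffles_iff_filter_eq {p q : ℕ} {σ : Equiv.Perm (Fin (p + q))} :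
    σ ∈ shuffles p q ↔ ∀ d, (List.ofFn σ).filter (inFirstBlock p · = d) =
      (List.finRange (p + q)).filter (inFirstBlock p · = d) := by
  have hblock {i j : Fin (p + q)} (hij : i < j) :
      ((j : ℕ) < p ∨ p ≤ (i : ℕ)) ↔ inFirstBlock p i = inFirstBlock p j := by
    have : (i : ℕ) < j := hij
    simp only [inFirstBlock, decide_eq_decide]
    omega
  have hshuffle : σ ∈ shuffles p q ↔
      ∀ i j, i < j → inFirstBlock p (σ i) = inFirstBlock p (σ j) → σ i < σ j := by
    rw [forall_lt_iff_forall_symm_lt, shuffles, Finset.mem_filter_univ]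
    exact forall₃_congr fun i j hij => by rw [hblock hij]
  simp only [hshuffle, filter_ofFn_perm_eq_iff]
  exact ⟨fun h d i j hij hi hj => h i j hij (hi.trans hj.symm),
    fun h i j hij hc => h _ i j hij hc rfl⟩

/-- The plane trees contributing to the shuffle relation of the word `0 1 … (p + q - 1)`: the
letters at their ends form a `(p, q)`-shuffle of it. -/
def shuffleTrees (p q : ℕ) : Finset (PlaneTree (Fin (p + q))) :=
  open Classical in (shuffles p q).biUnion fun σ => PlaneTree.withEnds (List.ofFn σ)

theorem mem_shuffleTrees_iff {p q : ℕ} {T : PlaneTree (Fin (p + q))} :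
    T ∈ shuffleTrees p q ↔ ∀ d, T.ends.filter (inFirstBlock p · = d) =
      (List.finRange (p + q)).filter (inFirstBlock p · = d) := by
  simp only [shuffleTrees, Finset.mem_biUnion, PlaneTree.mem_withEnds]
  constructor
  · rintro ⟨σ, hσ, hT⟩
    exact hT ▸ mem_shuffles_iff_filter_eq.1 hσ
  · intro h
    obtain ⟨σ, hσ⟩ := exists_perm_ofFn_eq (perm_of_filter_eq h)
    exact ⟨σ, mem_shuffles_iff_filter_eq.2 (hσ ▸ h), hσ.symm⟩

theorem mixed_of_mem_shuffleTrees {p q : ℕ} (hp : 1 ≤ p) (hq : 1 ≤ q)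
    {T : PlaneTree (Fin (p + q))} (hT : T ∈ shuffleTrees p q) : T.Mixed (inFirstBlock p) := by
  intro d hnil
  rw [mem_shuffleTrees_iff.1 hT, List.filter_eq_nil_iff] at hnil
  cases d with
  | true => exact hnil ⟨0, by omega⟩ (List.mem_finRange _) (by simp [inFirstBlock]; omega)
  | false => exact hnil ⟨p, by omega⟩ (List.mem_finRange _) (by simp [inFirstBlock])

theorem sum_shuffleTrees {R : Type*} [AddCommMonoid R] {p q : ℕ}
    (F : PlaneTree (Fin (p + q)) → R) :
    ∑ T ∈ shuffleTrees p q, F T =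
      ∑ σ ∈ shuffles p q, ∑ T ∈ PlaneTree.withEnds (List.ofFn σ), F T := by
  classical
  refine Finset.sum_biUnion fun σ _ τ _ hστ => Finset.disjoint_left.2 fun T hT hT' => hστ ?_
  rw [PlaneTree.mem_withEnds] at hT hT'
  exact DFunLike.coe_injective (List.ofFn_injective (hT.symm.trans hT'))

theorem sum_shuffles_withEnds {L R : Type*} [AddCommGroup R] {F : PlaneTree L → R}
    (hF : ∀ T T', PlaneTree.SwapRel T T' → F T' = -F T) {p q : ℕ} (hp : 1 ≤ p) (hq : 1 ≤ q)
    (l : Fin (p + q) → L) :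
    ∑ σ ∈ shuffles p q, ∑ T ∈ PlaneTree.withEnds (List.ofFn (l ∘ σ)), F T = 0 := by
  have hmixed {T} (hT : T ∈ shuffleTrees p q) := mixed_of_mem_shuffleTrees hp hq hT
  calc ∑ σ ∈ shuffles p q, ∑ T ∈ PlaneTree.withEnds (List.ofFn (l ∘ σ)), F T
      = ∑ T ∈ shuffleTrees p q, F (T.map l) := by
        simp only [sum_shuffleTrees, ← PlaneTree.sum_withEnds_map, List.map_ofFn]
    _ = 0 := by
        refine Finset.sum_involution (fun T _ => T.flip (inFirstBlock p)) (fun T hT => ?_)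
          (fun T hT _ => (hmixed hT).flip_ne) (fun T hT => ?_) (fun T hT => (hmixed hT).flip_flip)
        · rw [hF _ _ ((hmixed hT).swapRel_flip.map l), add_neg_cancel]
        · exact mem_shuffleTrees_iff.2 fun d => by
            rw [(hmixed hT).filter_ends_flip, mem_shuffleTrees_iff.1 hT]

end Shuffles

/-! ### Antisymmetry of `ω_r` and of `κ` -/

section Antisymmetry

variable {V : Type*}

theorem omegaForm_comp_perm {m : ℕ} (φ : Fin (m + 1) → (V → ℂ) → ℂ)
    (τ : Equiv.Perm (Fin (m + 1))) (z : V → ℂ) :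
    omegaForm (φ ∘ τ) z = ((Equiv.Perm.sign τ : ℤ) : ℂ) • omegaForm φ z := by
  unfold omegaForm
  rw [smul_comm]
  congr 1
  rw [Finset.smul_sum]
  refine Fintype.sum_equiv (Equiv.mulLeft τ) _ _ fun σ => ?_
  rw [smul_smul]
  congr 1
  simp only [Equiv.coe_mulLeft, map_mul, Units.val_mul, Int.cast_mul, ← mul_assoc]
  rw [← Int.cast_mul, ← Units.val_mul, Int.units_mul_self]
  simp

theorem omegaList_ofFn {m : ℕ} (φ : Fin (m + 1) → (V → ℂ) → ℂ) (z : V → ℂ) :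
    omegaList z (List.ofFn φ) = omegaForm φ z := by
  have eq_omegaForm : ∀ (n : ℕ) (l : List ((V → ℂ) → ℂ)) (h : l.length = n + 1),
      omegaList z l = omegaForm (m := n) (fun i => l.get (i.cast h.symm)) z := by
    rintro n (_ | ⟨f, fs⟩) h
    · simp at h
    · obtain rfl : fs.length = n := by simpa using h
      rfl
  rw [eq_omegaForm m _ (by simp)]
  congr 1
  funext i
  rw [List.get_ofFn]
  rfl

theorem SignedPerm.omegaList_eq {ε : ℤˣ} {l l' : List ((V → ℂ) → ℂ)} (h : SignedPerm ε l l')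
    (z : V → ℂ) : omegaList z l' = ((ε : ℤ) : ℂ) • omegaList z l := by
  obtain ⟨n, f, τ, rfl, rfl, rfl⟩ := h.exists_perm
  cases n with
  | zero => simp [omegaList]
  | succ m => rw [omegaList_ofFn, omegaList_ofFn, omegaForm_comp_perm]

theorem SignedPerm.prod_ι_eq {R M : Type*} [CommRing R] [AddCommGroup M] [Module R M] {ε : ℤˣ}
    {l l' : List M} (h : SignedPerm ε l l') : (l'.map (ExteriorAlgebra.ι R)).prod =
      ((ε : ℤ) : R) • (l.map (ExteriorAlgebra.ι R)).prod := by
  induction h with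
  | nil => simp
  | cons a _ ih => simp [ih]
  | swap a b l =>
    have hswap := ExteriorAlgebra.ι_add_mul_swap (R := R) b a
    simp only [List.map_cons, List.prod_cons, ← mul_assoc, eq_neg_of_add_eq_zero_left hswap]
    simp
  | trans _ _ ih ih' =>
    rw [ih', ih, smul_smul]
    simp [mul_comm]

theorem SignedPerm.exists_split {A B : Type*} {ε : ℤˣ} {l l' : List (A ⊕ B)}
    (h : SignedPerm ε l l') : ∃ ε₁ ε₂ : ℤˣ,
      SignedPerm ε₁ (l.filterMap Sum.getLeft?) (l'.filterMap Sum.getLeft?) ∧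
      SignedPerm ε₂ (l.filterMap Sum.getRight?) (l'.filterMap Sum.getRight?) ∧
      (-1) ^ inversions l' * (ε₁ * ε₂) = ε * (-1) ^ inversions l := by
  induction h with
  | nil => exact ⟨1, 1, .nil, .nil, rfl⟩
  | cons a _ ih =>
    obtain ⟨ε₁, ε₂, h₁, h₂, h⟩ := ih
    cases a with
    | inl a =>
      exact ⟨ε₁, ε₂, h₁.cons a, h₂, h⟩
    | inr b =>
      refine ⟨ε₁, ε₂, h₁, h₂.cons b, ?_⟩
      rw [inversions, inversions, pow_add, pow_add, mul_assoc, h, h₁.length_eq]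
      ac_rfl
  | swap a b l =>
    rcases a with a | a <;> rcases b with b | b
    · exact ⟨-1, 1, .swap a b _, .refl _, by simp [inversions]⟩
    · exact ⟨1, 1, .refl _, .refl _, by simp [inversions, pow_add, pow_succ]⟩
    · exact ⟨1, 1, .refl _, .refl _, by simp [inversions, pow_add, pow_succ]⟩
    · refine ⟨1, -1, .refl _, .swap a b _, ?_⟩
      change (-1) ^ inversions (.inr a :: .inr b :: l) * (1 * -1) = _
      rw [one_mul, mul_comm]
  | trans _ _ ih ih' =>
    obtain ⟨ε₁, ε₂, h₁, h₂, h⟩ := ih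
    obtain ⟨δ₁, δ₂, h₁', h₂', h'⟩ := ih'
    refine ⟨ε₁ * δ₁, ε₂ * δ₂, h₁.trans h₁', h₂.trans h₂', ?_⟩
    rw [show ε₁ * δ₁ * (ε₂ * δ₂) = δ₁ * δ₂ * (ε₁ * ε₂) by ac_rfl, ← mul_assoc, h', mul_assoc, h]
    ac_rfl

theorem SignedPerm.kappa_eq {X : Type*} [TopologicalSpace X] [ChartedSpace ℂ X]
    {V : Type} [Fintype V] {ε : ℤˣ} {E E' : List (((V → X) → ℝ) ⊕ (V × OneForms X))}
    (h : SignedPerm ε E E') (c : V → Chart X) (z : V → ℂ) :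
    kappa E' c z = ((ε : ℤ) : ℂ) • kappa E c z := by
  obtain ⟨ε₁, ε₂, h₁, h₂, h⟩ := h.exists_split
  have h₂' := (h₂.map fun p => oneFormAt c z p.1 p.2).prod_ι_eq (R := ℂ)
  simp only [List.map_map, Function.comp_def] at h₂'
  rw [kappa, kappa, (h₁.map fun F => localRep F c).omegaList_eq, h₂', smul_mul_smul_comm, smul_smul,
    smul_smul]
  congr 1
  have := congrArg (fun u : ℤˣ => ((u : ℤ) : ℂ)) h
  simpa using this

end Antisymmetry

/-! ### Invariance under renaming of the internal vertices -/

section Reindex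

variable {V W : Type*}

/-- The pullback of covectors along the isomorphism `ℂ ^ W ≃ ℂ ^ V` induced by `V ≃ W`. -/
def covReindex (φ : V ≃ W) : Cov V →ₗ[ℂ] Cov W where
  toFun θ := θ ∘ₗ LinearMap.funLeft ℝ ℂ φ
  map_add' _ _ := rfl
  map_smul' _ _ := rfl

/-- The pullback of forms along the isomorphism `ℂ ^ W ≃ ℂ ^ V` induced by `V ≃ W`. -/
def formReindex (φ : V ≃ W) : ExtForm V →ₐ[ℂ] ExtForm W := ExteriorAlgebra.map (covReindex φ)

theorem formReindex_ι (φ : V ≃ W) (θ : Cov V) :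
    formReindex φ (ExteriorAlgebra.ι ℂ θ) = ExteriorAlgebra.ι ℂ (covReindex φ θ) :=
  ExteriorAlgebra.map_apply_ι _ _

/-- The values of a covector on the frame given by an enumeration of `V`. -/
def evalFrameOf {V : Type*} {n : ℕ} (e : V ≃ Fin n) : Cov V →ₗ[ℂ] (Fin (n * 2) → ℂ) where
  toFun θ k := θ (open Classical in Pi.single (e.symm (finProdFinEquiv.symm k).1)
    (if (finProdFinEquiv.symm k).2 = 0 then 1 else Complex.I))
  map_add' _ _ := rfl
  map_smul' _ _ := rfl

/-- The coefficient of the top degree part of a form with respect to the frame given by an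
enumeration of `V`. -/
def topCoeffOf {V : Type*} {n : ℕ} (e : V ≃ Fin n) : ExtForm V →ₗ[ℂ] ℂ :=
  ExteriorAlgebra.liftAlternating
    (Pi.single (n * 2) (Matrix.detRowAlternating.compLinearMap (evalFrameOf e)))

theorem evalFrameOf_trans {n : ℕ} (e : V ≃ Fin n) (π : Equiv.Perm (Fin n)) (θ : Cov V) :
    evalFrameOf (e.trans π) θ = evalFrameOf e θ ∘
      (finProdFinEquiv.symm.trans
        ((Equiv.prodCongrLeft fun _ => π.symm).trans finProdFinEquiv)) := by
  ext k
  simp only [evalFrameOf, LinearMap.coe_mk, AddHom.coe_mk, Function.comp_apply, Equiv.trans_apply,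
    Equiv.symm_apply_apply]
  rfl

theorem topCoeffOf_trans {n : ℕ} (e : V ≃ Fin n) (π : Equiv.Perm (Fin n)) :
    topCoeffOf (e.trans π) = topCoeffOf e := by
  unfold topCoeffOf
  congr 2
  ext θ
  simp only [AlternatingMap.compLinearMap_apply, Matrix.detRowAlternating]
  change Matrix.det (fun i => evalFrameOf (e.trans π) (θ i)) =
    Matrix.det (fun i => evalFrameOf e (θ i))
  simp_rw [evalFrameOf_trans]
  -- `π` permutes the vectors `e_v` and the vectors `i e_v` simultaneously, so its sign cancels.
  have hsign : Equiv.Perm.sign ((finProdFinEquiv (m := n) (n := 2)).symm.trans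
      ((Equiv.prodCongrLeft fun _ => π.symm).trans finProdFinEquiv)) = 1 := by
    rw [← Equiv.trans_assoc, Equiv.Perm.sign_symm_trans_trans, Equiv.Perm.sign_prodCongrLeft]
    simp
  refine (Matrix.det_permute' _ fun i => evalFrameOf e (θ i)).trans ?_
  rw [hsign]
  simp

theorem topCoeffOf_eq {n m : ℕ} (e : V ≃ Fin n) (e' : V ≃ Fin m) :
    topCoeffOf e = topCoeffOf e' := by
  obtain rfl : n = m := by simpa using Fintype.card_congr (e.symm.trans e')
  rw [← topCoeffOf_trans e (e.symm.trans e')]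
  congr 1
  ext; simp

theorem topCoeffOf_formReindex (φ : V ≃ W) {n : ℕ} (e : W ≃ Fin n) (η : ExtForm V) :
    topCoeffOf e (formReindex φ η) = topCoeffOf (φ.trans e) η := by
  suffices h : topCoeffOf e ∘ₗ (formReindex φ).toLinearMap = topCoeffOf (φ.trans e) from
    LinearMap.congr_fun h η
  apply ExteriorAlgebra.lhom_ext
  intro k
  ext θ
  simp only [LinearMap.compAlternatingMap_apply, LinearMap.comp_apply, AlgHom.toLinearMap_apply,
    formReindex, ExteriorAlgebra.map_apply_ιMulti, topCoeffOf,
    ExteriorAlgebra.liftAlternating_apply_ιMulti]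
  by_cases hk : k = n * 2
  · subst hk
    simp only [Pi.single_eq_same, AlternatingMap.compLinearMap_apply]
    congr 1
    ext i j
    simp only [evalFrameOf, covReindex, LinearMap.coe_mk, AddHom.coe_mk, Function.comp_apply,
      LinearMap.comp_apply]
    congr 1
    ext v
    classical
    simp [LinearMap.funLeft, Pi.single_apply, Equiv.eq_symm_apply]
  · simp [Pi.single_eq_of_ne hk]

theorem fderiv_comp_reindex [Finite V] (φ : V ≃ W) (f : (V → ℂ) → ℂ) (z : W → ℂ) :
    (fderiv ℝ (fun y : W → ℂ => f (y ∘ φ)) z).toLinearMap =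
      (fderiv ℝ f (z ∘ φ)).toLinearMap ∘ₗ LinearMap.funLeft ℝ ℂ φ := by
  have := Fintype.ofFinite V
  have := Fintype.ofEquiv V φ
  exact congrArg ContinuousLinearMap.toLinearMap
    ((LinearEquiv.funCongrLeft ℝ ℂ φ).toContinuousLinearEquiv.comp_right_fderiv (f := f) (x := z))

theorem del_comp_reindex [Finite V] (φ : V ≃ W) (f : (V → ℂ) → ℂ) (z : W → ℂ) :
    del (fun y : W → ℂ => f (y ∘ φ)) z = covReindex φ (del f (z ∘ φ)) := by
  rw [del, fderiv_comp_reindex]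
  rfl

theorem delbar_comp_reindex [Finite V] (φ : V ≃ W) (f : (V → ℂ) → ℂ) (z : W → ℂ) :
    delbar (fun y : W → ℂ => f (y ∘ φ)) z = covReindex φ (delbar f (z ∘ φ)) := by
  rw [delbar, fderiv_comp_reindex]
  rfl

theorem omegaForm_comp_reindex [Finite V] (φ : V ≃ W) {m : ℕ} (f : Fin (m + 1) → (V → ℂ) → ℂ)
    (z : W → ℂ) :
    omegaForm (fun i (y : W → ℂ) => f i (y ∘ φ)) z = formReindex φ (omegaForm f (z ∘ φ)) := by
  simp only [omegaForm, map_smul, map_sum, map_list_prod, List.map_ofFn, Function.comp_def,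
    formReindex_ι]
  simp only [apply_ite (covReindex φ)]
  simp only [← Function.comp_def z φ, ← del_comp_reindex, ← delbar_comp_reindex]
  rfl

theorem omegaList_comp_reindex [Finite V] (φ : V ≃ W) (l : List ((V → ℂ) → ℂ)) (z : W → ℂ) :
    omegaList z (l.map fun f (y : W → ℂ) => f (y ∘ φ)) = formReindex φ (omegaList (z ∘ φ) l) := by
  obtain ⟨n, f, rfl⟩ : ∃ (n : ℕ) (f : Fin n → (V → ℂ) → ℂ), l = List.ofFn f :=
    ⟨_, l.get, by simp⟩
  cases n with
  | zero => simp [omegaList]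
  | succ m =>
    rw [List.map_ofFn, omegaList_ofFn, omegaList_ofFn, ← omegaForm_comp_reindex]
    rfl

theorem topCoeff_eq_topCoeffOf [Fintype V] :
    topCoeff (V := V) = topCoeffOf (Fintype.equivFin V) := rfl

theorem topCoeff_formReindex [Fintype V] [Fintype W] (φ : V ≃ W) (η : ExtForm V) :
    topCoeff (formReindex φ η) = topCoeff η := by
  rw [topCoeff_eq_topCoeffOf, topCoeff_eq_topCoeffOf, topCoeffOf_formReindex]
  exact LinearMap.congr_fun (topCoeffOf_eq _ _) η

end Reindex

section ReindexTerms

variable {X : Type*} [TopologicalSpace X] [ChartedSpace ℂ X] {V W : Type}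

/-- Renaming of the vertices in the contribution of an edge. -/
def termReindex (φ : V ≃ W) :
    ((V → X) → ℝ) ⊕ (V × OneForms X) → ((W → X) → ℝ) ⊕ (W × OneForms X) :=
  Sum.map (fun F y => F (y ∘ φ)) (Prod.map φ id)

theorem edgeTerm_reindex {S : Finset X} (G : X → X → ℝ) (φ : V ≃ W)
    (E : (V ⊕ Letter S) × (V ⊕ Letter S)) :
    edgeTerm G (Prod.map (Sum.map φ id) (Sum.map φ id) E) = termReindex φ (edgeTerm G E) := by
  rcases E with ⟨u | s | η, v | s' | η'⟩ <;> rfl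

theorem filterMap_getLeft_map {A B A' B' : Type*} (f : A → A') (g : B → B') (l : List (A ⊕ B)) :
    (l.map (Sum.map f g)).filterMap Sum.getLeft? = (l.filterMap Sum.getLeft?).map f := by
  simp only [List.filterMap_map, List.map_filterMap, Function.comp_def, Sum.getLeft?_map]

theorem filterMap_getRight_map {A B A' B' : Type*} (f : A → A') (g : B → B') (l : List (A ⊕ B)) :
    (l.map (Sum.map f g)).filterMap Sum.getRight? = (l.filterMap Sum.getRight?).map g := by
  simp only [List.filterMap_map, List.map_filterMap, Function.comp_def, Sum.getRight?_map]

theorem inversions_map {A B A' B' : Type*} (f : A → A') (g : B → B') (l : List (A ⊕ B)) :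
    inversions (l.map (Sum.map f g)) = inversions l := by
  induction l with
  | nil => rfl
  | cons a l ih =>
    rcases a with a | b
    · simpa only [List.map_cons, Sum.map_inl, inversions] using ih
    · simp only [List.map_cons, Sum.map_inr, inversions, ih, filterMap_getLeft_map,
        List.length_map]

theorem kappa_reindex [Fintype V] [Fintype W] (φ : V ≃ W)
    (E : List (((V → X) → ℝ) ⊕ (V × OneForms X))) (c : W → Chart X) (z : W → ℂ) :
    kappa (E.map (termReindex φ)) c z = formReindex φ (kappa E (c ∘ φ) (z ∘ φ)) := by
  rw [kappa, kappa, termReindex, inversions_map, filterMap_getLeft_map, filterMap_getRight_map,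
    map_smul, map_mul,
    map_list_prod, ← omegaList_comp_reindex]
  simp only [List.map_map, Function.comp_def, formReindex_ι]
  rfl

end ReindexTerms

/-! ### Integrals of trees -/

namespace PlaneTree

variable {L : Type*}

/-- The end point of the root edge other than the root. -/
def rootEnd {V : Type} : (T : PlaneTree L) → (T.Vert → V) → V ⊕ L
  | .leaf l, _ => .inr l
  | .node _ _, i => .inl (i none)

/-- The edges other than the root edge. -/
def nonrootEdges {V : Type} : (T : PlaneTree L) → (T.Vert → V) → List ((V ⊕ L) × (V ⊕ L))
  | .leaf _, _ => []
  | .node s t, i =>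
    s.edges (fun v => i (some (.inl v))) (.inl (i none)) ++
      t.edges (fun v => i (some (.inr v))) (.inl (i none))

theorem edges_eq {V : Type} (T : PlaneTree L) (i : T.Vert → V) (p : V ⊕ L) :
    T.edges i p = (p, T.rootEnd i) :: T.nonrootEdges i := by
  cases T <;> rfl

theorem odd_length_edges {V : Type} (T : PlaneTree L) (i : T.Vert → V) (p : V ⊕ L) :
    Odd (T.edges i p).length := by
  induction T generalizing p with
  | leaf l => exact odd_one
  | node s t ihs iht =>
    simp only [edges, List.length_cons, List.length_append]
    exact ((ihs _ _).add_odd (iht _ _)).add_one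

theorem edges_map {V W : Type} (φ : V → W) (T : PlaneTree L) (i : T.Vert → V) (p : V ⊕ L) :
    (T.edges i p).map (Prod.map (Sum.map φ id) (Sum.map φ id)) =
      T.edges (φ ∘ i) (Sum.map φ id p) := by
  induction T generalizing p with
  | leaf l => rfl
  | node s t ihs iht =>
    simp only [edges, List.map_cons, List.map_append, ihs, iht]
    rfl

theorem rootEnd_map {V W : Type} (φ : V → W) (T : PlaneTree L) (i : T.Vert → V) :
    Sum.map φ id (T.rootEnd i) = T.rootEnd (φ ∘ i) := by
  cases T <;> rfl

theorem nonrootEdges_map {V W : Type} (φ : V → W) (T : PlaneTree L) (i : T.Vert → V) :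
    (T.nonrootEdges i).map (Prod.map (Sum.map φ id) (Sum.map φ id)) = T.nonrootEdges (φ ∘ i) := by
  cases T with
  | leaf l => rfl
  | node s t =>
    simp only [nonrootEdges, List.map_append, edges_map]
    rfl

theorem SwapRel.exists_equiv {T T' : PlaneTree L} (h : SwapRel T T') :
    ∃ φ : T'.Vert ≃ T.Vert, ∀ {V : Type} (i : T.Vert → V) (p : V ⊕ L),
      SignedPerm (-1) (T.edges i p) (T'.edges (i ∘ φ) p) := by
  induction h with
  | swap s t =>
    refine ⟨Equiv.optionCongr (Equiv.sumComm t.Vert s.Vert), fun i p => ?_⟩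
    refine SignedPerm.cons _ ((SignedPerm.append_comm _ _).of_eq ?_)
    exact ((odd_length_edges _ _ _).mul (odd_length_edges _ _ _)).neg_one_pow
  | @left s s' t _ ih =>
    obtain ⟨φ, hφ⟩ := ih
    refine ⟨Equiv.optionCongr (Equiv.sumCongr φ (Equiv.refl t.Vert)), fun i p => ?_⟩
    exact SignedPerm.cons _ ((hφ _ _).append_right _)
  | @right s t t' _ ih =>
    obtain ⟨φ, hφ⟩ := ih
    refine ⟨Equiv.optionCongr (Equiv.sumCongr (Equiv.refl s.Vert) φ), fun i p => ?_⟩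
    exact SignedPerm.cons _ ((hφ _ _).append_left _)

/-- The edges of the union of two trees along their root edges, in canonical order, the common edge
coming first. -/
def glue {V : Type} (T R : PlaneTree L) (i : T.Vert → V) (j : R.Vert → V) :
    List ((V ⊕ L) × (V ⊕ L)) :=
  (R.rootEnd j, T.rootEnd i) :: (T.nonrootEdges i ++ R.nonrootEdges j)

theorem glue_map {V W : Type} (φ : V → W) (T R : PlaneTree L) (i : T.Vert → V) (j : R.Vert → V) :
    (T.glue R i j).map (Prod.map (Sum.map φ id) (Sum.map φ id)) = T.glue R (φ ∘ i) (φ ∘ j) := by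
  simp [glue, nonrootEdges_map, rootEnd_map]

/-- Rerooting: the leftmost end of `T` becomes the root of the union of `T` and `R`. -/
def reroot : PlaneTree L → PlaneTree L → L × PlaneTree L
  | .leaf l, R => (l, R)
  | .node s t, R => s.reroot (.node t R)

/-- Rerooting: the rightmost end of `R` becomes the root of the union of `T` and `R`. -/
def rerootBack (T : PlaneTree L) : PlaneTree L → L × PlaneTree L
  | .leaf l => (l, T)
  | .node t R => rerootBack (.node T t) R

theorem cons_ends_reroot (T R : PlaneTree L) :
    (T.reroot R).1 :: (T.reroot R).2.ends = T.ends ++ R.ends := by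
  induction T generalizing R with
  | leaf l => rfl
  | node s t ihs _ => rw [reroot, ihs]; simp [ends]

theorem rerootBack_reroot (T R : PlaneTree L) :
    (leaf (T.reroot R).1).rerootBack (T.reroot R).2 = T.rerootBack R := by
  induction T generalizing R with
  | leaf l => rfl
  | node s t ihs _ => rw [reroot, ihs, rerootBack]

theorem reroot_rerootBack (T R : PlaneTree L) :
    (T.rerootBack R).2.reroot (leaf (T.rerootBack R).1) = T.reroot R := by
  induction R generalizing T with
  | leaf l => rfl
  | node t R _ ih => rw [rerootBack, ih, reroot]

/-- Rerooting of a tree with decorated root at its leftmost end. -/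
def rerootEquiv : L × PlaneTree L ≃ L × PlaneTree L where
  toFun P := P.2.reroot (leaf P.1)
  invFun P := (leaf P.1).rerootBack P.2
  left_inv P := P.2.rerootBack_reroot (leaf P.1)
  right_inv P := (leaf P.1).reroot_rerootBack P.2

theorem cons_ends_rerootEquiv (P : L × PlaneTree L) :
    (rerootEquiv P).1 :: (rerootEquiv P).2.ends = (P.1 :: P.2.ends).rotate 1 := by
  rw [List.rotate_cons_succ, List.rotate_zero]
  exact P.2.cons_ends_reroot (leaf P.1)

end PlaneTree

theorem edgeTerm_symm {X : Type*} [TopologicalSpace X] [ChartedSpace ℂ X] {S : Finset X}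
    {G : X → X → ℝ} (hG : ∀ x y, G x y = G y x) {V : Type} (a b : V ⊕ Letter S) :
    edgeTerm G (a, b) = edgeTerm G (b, a) := by
  rcases a with u | s | η <;> rcases b with v | s' | η' <;> simp [edgeTerm, hG]

section EdgeIntegral

theorem sigmaFinite_map_symm {X Y : Type*} [TopologicalSpace X] [MeasurableSpace X] [BorelSpace X]
    [TopologicalSpace Y] [MeasurableSpace Y] [BorelSpace Y] (e : OpenPartialHomeomorph X Y)
    (ν : Measure Y) [SigmaFinite ν] {A : Set Y} (hA : A ⊆ e.target) :
    SigmaFinite ((ν.restrict A).map e.symm) := by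
  have hle : ν.restrict A ≤ ν.restrict e.target := Measure.restrict_mono_set ν hA
  have hmem : ∀ᵐ y ∂ν.restrict A, y ∈ e.target :=
    ae_mono hle (ae_restrict_mem e.open_target.measurableSet)
  have hsymm : AEMeasurable e.symm (ν.restrict A) :=
    (e.continuousOn_symm.aemeasurable e.open_target.measurableSet).mono_measure hle
  have hsource : ∀ᵐ x ∂(ν.restrict A).map e.symm, x ∈ e.source :=
    (ae_map_iff hsymm e.open_source.measurableSet).2 (hmem.mono fun _ => e.map_target)
  have he : AEMeasurable e ((ν.restrict A).map e.symm) := by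
    rw [← Measure.restrict_eq_self_of_ae_mem hsource]
    exact e.continuousOn.aemeasurable e.open_source.measurableSet
  refine SigmaFinite.of_map _ he ?_
  rw [AEMeasurable.map_map_of_aemeasurable he hsymm,
    Measure.map_congr (hmem.mono fun y hy => e.right_inv hy : e ∘ e.symm =ᵐ[ν.restrict A] id),
    Measure.map_id]
  infer_instance

variable {X : Type*} [TopologicalSpace X] [ChartedSpace ℂ X]
  [CompactSpace X] [MeasurableSpace X] [BorelSpace X]

instance sigmaFinite_chartMeasure : SigmaFinite (chartMeasure X) := by
  rw [chartMeasure, ← Finset.sum_coe_sort, ← Measure.sum_fintype]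
  have (e : Chart X) := sigmaFinite_map_symm e.1 volume
    (A := e.1.target ∩ e.1.symm ⁻¹' (chartSel X ⁻¹' {e})) Set.inter_subset_left
  infer_instance

variable {S : Finset X} (G : X → X → ℝ)

/-- The integral over `X ^ V` of the form attached to a list of edges. -/
def edgeIntegral {V : Type} [Fintype V] (E : List ((V ⊕ Letter S) × (V ⊕ Letter S))) : ℂ :=
  ∫ x : V → X, topCoeff (kappa (E.map (edgeTerm G))
    (fun v => chartSel X (x v)) (fun v => (chartSel X (x v)).1 (x v)))
    ∂(Measure.pi fun _ => chartMeasure X)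

theorem treeIntegral_eq_edgeIntegral (l : Letter S) (T : PlaneTree (Letter S)) :
    treeIntegral G l T = edgeIntegral G (T.edges id (.inr l)) := rfl

theorem edgeIntegral_reindex {V W : Type} [Fintype V] [Fintype W] (φ : V ≃ W)
    (E : List ((V ⊕ Letter S) × (V ⊕ Letter S))) :
    edgeIntegral G (E.map (Prod.map (Sum.map φ id) (Sum.map φ id))) = edgeIntegral G E := by
  have hterm : edgeTerm G ∘ Prod.map (Sum.map φ id) (Sum.map φ id) =
      termReindex φ ∘ edgeTerm (S := S) G := funext (edgeTerm_reindex G φ)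
  rw [edgeIntegral, edgeIntegral, ← (measurePreserving_piCongrLeft
    (fun _ : W => chartMeasure X) φ).symm.integral_comp']
  congr 1
  funext x
  rw [List.map_map, hterm, ← List.map_map, kappa_reindex, topCoeff_formReindex]
  rfl

theorem SignedPerm.edgeIntegral_eq {V : Type} [Fintype V] {ε : ℤˣ}
    {E E' : List ((V ⊕ Letter S) × (V ⊕ Letter S))} (h : SignedPerm ε E E') :
    edgeIntegral G E' = ((ε : ℤ) : ℂ) * edgeIntegral G E := by
  rw [edgeIntegral, edgeIntegral, ← integral_const_mul]
  congr 1
  funext x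
  rw [(h.map (edgeTerm G)).kappa_eq, map_smul, smul_eq_mul]

theorem PlaneTree.SwapRel.treeIntegral_eq (l : Letter S) {T T' : PlaneTree (Letter S)}
    (h : SwapRel T T') : treeIntegral G l T' = -treeIntegral G l T := by
  obtain ⟨φ, hφ⟩ := h.exists_equiv
  rw [treeIntegral_eq_edgeIntegral, treeIntegral_eq_edgeIntegral, ← edgeIntegral_reindex G φ,
    edges_map]
  simpa using (hφ id (.inr l)).edgeIntegral_eq G

/-- The tree integral of the union of two trees along their root edges. -/
def glueIntegral (T R : PlaneTree (Letter S)) : ℂ :=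
  edgeIntegral G (V := T.Vert ⊕ R.Vert) (T.glue R Sum.inl Sum.inr)

theorem edgeIntegral_glue {V : Type} [Fintype V] (T R : PlaneTree (Letter S))
    (φ : T.Vert ⊕ R.Vert ≃ V) :
    edgeIntegral G (T.glue R (φ ∘ Sum.inl) (φ ∘ Sum.inr)) = glueIntegral G T R := by
  rw [glueIntegral, ← edgeIntegral_reindex G φ, PlaneTree.glue_map]

theorem glueIntegral_leaf_right (T : PlaneTree (Letter S)) (l : Letter S) :
    glueIntegral G T (.leaf l) = treeIntegral G l T := by
  rw [← edgeIntegral_glue G T (.leaf l) (Equiv.sumEmpty T.Vert Empty : T.Vert ⊕ Empty ≃ T.Vert),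
    treeIntegral_eq_edgeIntegral, PlaneTree.edges_eq, PlaneTree.glue]
  simp only [PlaneTree.nonrootEdges, List.append_nil]
  rfl

variable {G}

theorem edgeIntegral_cons_symm (hG : ∀ x y, G x y = G y x)
    {V : Type} [Fintype V] (a b : V ⊕ Letter S)
    (E : List ((V ⊕ Letter S) × (V ⊕ Letter S))) :
    edgeIntegral G ((a, b) :: E) = edgeIntegral G ((b, a) :: E) := by
  simp only [edgeIntegral, List.map_cons, edgeTerm_symm hG a b]

theorem glueIntegral_leaf_left (hG : ∀ x y, G x y = G y x)
    (l : Letter S) (R : PlaneTree (Letter S)) :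
    glueIntegral G (.leaf l) R = treeIntegral G l R := by
  rw [← edgeIntegral_glue G (.leaf l) R (Equiv.emptySum Empty R.Vert : Empty ⊕ R.Vert ≃ R.Vert),
    treeIntegral_eq_edgeIntegral, PlaneTree.edges_eq, PlaneTree.glue, edgeIntegral_cons_symm hG]
  simp only [PlaneTree.nonrootEdges, List.nil_append]
  rfl

/-- The identification of the internal vertices of the union of `node s t` and `R` with those of the
union of `s` and `node t R`. -/
def optionSumAssoc (A B C : Type) : Option (A ⊕ B) ⊕ C ≃ A ⊕ Option (B ⊕ C) where
  toFun
    | .inl none => .inr none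
    | .inl (some (.inl a)) => .inl a
    | .inl (some (.inr b)) => .inr (some (.inl b))
    | .inr c => .inr (some (.inr c))
  invFun
    | .inl a => .inl (some (.inl a))
    | .inr none => .inl none
    | .inr (some (.inl b)) => .inl (some (.inr b))
    | .inr (some (.inr c)) => .inr c
  left_inv := by rintro ((_ | a | b) | c) <;> rfl
  right_inv := by rintro (a | _ | b | c) <;> rfl

theorem edgeIntegral_move_root (hG : ∀ x y, G x y = G y x) (s t R : PlaneTree (Letter S))
    {V : Type} [Fintype V] (i : s.Vert → V) (j : t.Vert → V) (k : R.Vert → V) (v : V) :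
    edgeIntegral G ((R.rootEnd k, .inl v) ::
        (s.edges i (.inl v) ++ t.edges j (.inl v) ++ R.nonrootEdges k)) =
      edgeIntegral G ((.inl v, s.rootEnd i) ::
        (s.nonrootEdges i ++ (t.edges j (.inl v) ++ R.edges k (.inl v)))) := by
  -- Trees have an odd number of edges, so moving an edge past two of them costs no sign.
  have heven := (s.odd_length_edges i (.inl v)).add_odd (t.odd_length_edges j (.inl v))
  rw [← List.length_append] at heven
  have h := ((SignedPerm.cons_append (.inl v, R.rootEnd k)
    (s.edges i (.inl v) ++ t.edges j (.inl v)) (R.nonrootEdges k)).of_eq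
      heven.neg_one_pow).edgeIntegral_eq G
  rw [Units.val_one, Int.cast_one, one_mul, edgeIntegral_cons_symm hG, ← R.edges_eq,
    List.append_assoc] at h
  rw [← h, s.edges_eq, List.cons_append]

theorem glueIntegral_node (hG : ∀ x y, G x y = G y x) (s t R : PlaneTree (Letter S)) :
    glueIntegral G (.node s t) R = glueIntegral G s (.node t R) := by
  let φ : (PlaneTree.node s t).Vert ⊕ R.Vert ≃ s.Vert ⊕ (PlaneTree.node t R).Vert :=
    optionSumAssoc s.Vert t.Vert R.Vert
  rw [← edgeIntegral_glue G (.node s t) R φ]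
  exact edgeIntegral_move_root hG s t R (V := s.Vert ⊕ (PlaneTree.node t R).Vert)
    Sum.inl (fun v => .inr (some (.inl v))) (fun v => .inr (some (.inr v))) (.inr none)

theorem treeIntegral_reroot (hG : ∀ x y, G x y = G y x) (T R : PlaneTree (Letter S)) :
    treeIntegral G (T.reroot R).1 (T.reroot R).2 = glueIntegral G T R := by
  induction T generalizing R with
  | leaf l => exact (glueIntegral_leaf_left hG l R).symm
  | node s t ihs _ => rw [PlaneTree.reroot, ihs, glueIntegral_node hG]

theorem treeIntegral_rerootEquiv (hG : ∀ x y, G x y = G y x)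
    (P : Letter S × PlaneTree (Letter S)) :
    treeIntegral G (PlaneTree.rerootEquiv P).1 (PlaneTree.rerootEquiv P).2 =
      treeIntegral G P.1 P.2 :=
  (treeIntegral_reroot hG P.2 (.leaf P.1)).trans (glueIntegral_leaf_right G P.2 P.1)

theorem corWord_eq_finsum (w : List (Letter S)) :
    corWord G w = ∑ᶠ P : {P : Letter S × PlaneTree (Letter S) // P.1 :: P.2.ends = w},
      treeIntegral G P.1.1 P.1.2 := by
  cases w with
  | nil =>
    have : IsEmpty {P : Letter S × PlaneTree (Letter S) // P.1 :: P.2.ends = []} :=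
      ⟨fun P => List.cons_ne_nil _ _ P.2⟩
    rw [finsum_of_isEmpty, corWord]
  | cons l w =>
    let e : {T : PlaneTree (Letter S) // T.ends = w} ≃
        {P : Letter S × PlaneTree (Letter S) // P.1 :: P.2.ends = l :: w} :=
      { toFun T := ⟨(l, T.1), by rw [T.2]⟩
        invFun P := ⟨P.1.2, (List.cons.inj P.2).2⟩
        left_inv _ := rfl
        right_inv P := Subtype.ext (Prod.ext (List.cons.inj P.2).1.symm rfl) }
    exact finsum_comp_equiv e (f := fun P => treeIntegral G P.1.1 P.1.2)

theorem corWord_rotate (hG : ∀ x y, G x y = G y x) (w : List (Letter S)) (n : ℕ) :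
    corWord G (w.rotate n) = corWord G w := by
  induction n with
  | zero => rw [List.rotate_zero]
  | succ n ih =>
    rw [← ih, ← List.rotate_rotate, corWord_eq_finsum, corWord_eq_finsum]
    have hword (P : Letter S × PlaneTree (Letter S)) : P.1 :: P.2.ends = w.rotate n ↔
        (PlaneTree.rerootEquiv P).1 :: (PlaneTree.rerootEquiv P).2.ends =
          (w.rotate n).rotate 1 := by
      rw [PlaneTree.cons_ends_rerootEquiv, List.rotate_eq_rotate]
    rw [← finsum_comp_equiv (PlaneTree.rerootEquiv.subtypeEquiv hword)]
    exact finsum_congr fun P => treeIntegral_rerootEquiv hG P.1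

theorem corWord_append_comm (hG : ∀ x y, G x y = G y x) (w w' : List (Letter S)) :
    corWord G (w ++ w') = corWord G (w' ++ w) := by
  rw [← corWord_rotate hG (w ++ w') w.length, List.rotate_append_length_eq]

end EdgeIntegral

/-! ### Harmonic functions on a Riemann surface -/

section Harmonic

open Filter Topology InnerProductSpace Laplacian

/-- By the open mapping theorem, a holomorphic function whose real part has a local maximum is
locally constant. -/
theorem eventually_eq_of_harmonicAt_of_isLocalMax {u : ℂ → ℝ} {w : ℂ} (hu : HarmonicAt u w)
    (hmax : IsLocalMax u w) : ∀ᶠ z in 𝓝 w, u z = u w := by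
  obtain ⟨R, hR, hball⟩ := Metric.eventually_nhds_iff_ball.1 hu.eventually
  obtain ⟨F, hF, hFu⟩ := HarmonicOnNhd.exists_analyticOnNhd_ball_re_eq (f := u) hball
  have hw : w ∈ Metric.ball w R := Metric.mem_ball_self hR
  have hre : ∀ᶠ z in 𝓝 w, (F z).re = u z :=
    (Metric.isOpen_ball.eventually_mem hw).mono fun z hz => hFu hz
  rcases (hF w hw).eventually_constant_or_nhds_le_map_nhds with hconst | hopen
  · filter_upwards [hconst, hre] with z hz hz'
    rw [← hz', hz]
    exact hFu hw
  · have hle : ∀ᶠ ζ in 𝓝 (F w), ζ.re ≤ (F w).re := by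
      refine hopen (mem_map.2 ?_)
      filter_upwards [hre, hmax] with z hz hz'
      rw [Set.mem_preimage, Set.mem_ofPred_eq, hz, hre.self_of_nhds]
      exact hz'
    have hline : Tendsto (fun t : ℝ => F w + t) (𝓝[>] 0) (𝓝 (F w)) := by
      refine tendsto_nhdsWithin_of_tendsto_nhds ?_
      exact Continuous.tendsto' (by fun_prop) _ _ (by simp)
    obtain ⟨t, ht, ht0⟩ := ((hline.eventually hle).and self_mem_nhdsWithin).exists
    rw [Complex.add_re, Complex.ofReal_re, add_le_iff_nonpos_right] at ht
    exact absurd ht0 ht.not_gt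

theorem continuousAt_laplacian {E F : Type*} [NormedAddCommGroup E] [InnerProductSpace ℝ E]
    [FiniteDimensional ℝ E] [NormedAddCommGroup F] [NormedSpace ℝ F] {f : E → F} {x : E}
    (hf : ContDiffAt ℝ 2 f x) : ContinuousAt (Δ f) x := by
  rw [laplacian_eq_iteratedFDeriv_stdOrthonormalBasis]
  have h2 : ContinuousAt (iteratedFDeriv ℝ 2 f) x := hf.continuousAt_iteratedFDeriv le_rfl
  exact tendsto_finsetSum _ fun i _ =>
    (ContinuousMultilinearMap.apply ℝ (fun _ : Fin 2 => E) F _).continuous.continuousAt.comp h2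

theorem harmonicAt_of_eventually_laplacian_eq_zero {E F : Type*} [NormedAddCommGroup E]
    [InnerProductSpace ℝ E] [FiniteDimensional ℝ E] [Nontrivial E] [NormedAddCommGroup F]
    [NormedSpace ℝ F] {f : E → F} {x : E} (hf : ContDiffAt ℝ 2 f x)
    (hΔ : ∀ᶠ y in 𝓝[≠] x, Δ f y = 0) : HarmonicAt f x := by
  have hx : Δ f x = 0 :=
    tendsto_nhds_unique_of_eventuallyEq
      ((continuousAt_laplacian hf).tendsto.mono_left nhdsWithin_le_nhds) tendsto_const_nhds hΔ
  refine ⟨hf, ?_⟩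
  filter_upwards [eventually_nhdsWithin_iff.1 hΔ] with y hy
  rcases eq_or_ne y x with rfl | hne
  · exact hx
  · exact hy hne

variable {X : Type*} [TopologicalSpace X] [ChartedSpace ℂ X]

/-- A function on a Riemann surface is harmonic if it is so in local coordinates. Near each point
only the preferred chart is used: the notion does not depend on the chart. -/
def IsHarmonic (u : X → ℝ) : Prop := ∀ x, HarmonicAt (u ∘ (chartAt ℂ x).symm) (chartAt ℂ x x)

theorem tendsto_chartAt_symm (x : X) :
    Tendsto (chartAt ℂ x).symm (𝓝 (chartAt ℂ x x)) (𝓝 x) :=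
  (chartAt ℂ x).tendsto_symm (mem_chart_source ℂ x)

theorem IsHarmonic.continuous {u : X → ℝ} (hu : IsHarmonic u) : Continuous u := by
  refine continuous_iff_continuousAt.2 fun x => ?_
  have hc := (chartAt ℂ x).continuousAt (mem_chart_source ℂ x)
  refine (ContinuousAt.comp (hu x).1.continuousAt hc).congr ?_
  filter_upwards [(chartAt ℂ x).eventually_left_inverse (mem_chart_source ℂ x)] with y hy
  simp only [Function.comp_apply, hy]

theorem IsHarmonic.eventually_eq_of_isLocalMax {u : X → ℝ} (hu : IsHarmonic u) {x : X}
    (hx : IsLocalMax u x) : ∀ᶠ y in 𝓝 x, u y = u x := by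
  have hs := mem_chart_source ℂ x
  have hmax : IsLocalMax (u ∘ (chartAt ℂ x).symm) (chartAt ℂ x x) := by
    filter_upwards [(tendsto_chartAt_symm x).eventually hx] with w hw
    simpa only [Function.comp_apply, (chartAt ℂ x).left_inv hs] using hw
  have hconst := eventually_eq_of_harmonicAt_of_isLocalMax (hu x) hmax
  filter_upwards [((chartAt ℂ x).continuousAt hs).eventually hconst,
    (chartAt ℂ x).eventually_left_inverse hs] with y hy hy'
  simpa only [Function.comp_apply, hy', (chartAt ℂ x).left_inv hs] using hy

theorem IsHarmonic.eq [CompactSpace X] [PreconnectedSpace X] {u : X → ℝ} (hu : IsHarmonic u)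
    (x y : X) : u x = u y := by
  obtain ⟨m, -, hm⟩ := isCompact_univ.exists_isMaxOn ⟨x, Set.mem_univ x⟩ hu.continuous.continuousOn
  have hclopen : IsClopen {y | u y = u m} := by
    refine ⟨isClosed_eq hu.continuous continuous_const, isOpen_iff_mem_nhds.2 fun z hz => ?_⟩
    have hz' : u z = u m := hz
    have hmax : IsLocalMax u z := Eventually.of_forall fun y => hz' ▸ hm (Set.mem_univ y)
    filter_upwards [hu.eventually_eq_of_isLocalMax hmax] with y hy using hy.trans hz'
  have huniv (y : X) : u y = u m := Set.eq_univ_iff_forall.1 (hclopen.eq_univ ⟨m, rfl⟩) y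
  rw [huniv x, huniv y]

instance neBot_nhdsNE (x : X) : (𝓝[≠] x).NeBot := by
  rw [neBot_iff, Ne, ← isOpen_singleton_iff_punctured_nhds]
  intro hopen
  have himage := (chartAt ℂ x).isOpen_image_of_subset_source hopen (by simp)
  rw [Set.image_singleton] at himage
  exact not_isOpen_singleton _ himage

theorem exists_isHarmonic_eqOn_of_mem_codiscrete {U : Set X} (hU : U ∈ codiscrete X) {u : X → ℝ}
    (hu : ∀ x, ∃ H, HarmonicAt H (chartAt ℂ x x) ∧ ∀ᶠ y in 𝓝 x, y ∈ U → u y = H (chartAt ℂ x y)) :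
    ∃ v, IsHarmonic v ∧ U.EqOn u v := by
  have hU' (x : X) : ∀ᶠ y in 𝓝[≠] x, y ∈ U := by simpa using mem_codiscrete.1 hU x
  choose H hH hE using hu
  let v (x : X) : ℝ := H x (chartAt ℂ x x)
  -- Near `x`, the local extensions at `x` and at `y` agree on `U`, hence at `y` by continuity.
  have hv (x : X) : ∀ᶠ y in 𝓝 x, v y = H x (chartAt ℂ x y) := by
    have hs := mem_chart_source ℂ x
    filter_upwards [(hE x).eventually_nhds, (chartAt ℂ x).open_source.eventually_mem hs,
      ((chartAt ℂ x).continuousAt hs).eventually (hH x).eventually] with y hy hys hHy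
    have hcy : ContinuousAt (fun y' => H y (chartAt ℂ y y')) y :=
      ContinuousAt.comp (g := H y) (hH y).1.continuousAt
        ((chartAt ℂ y).continuousAt (mem_chart_source ℂ y))
    have hcx : ContinuousAt (fun y' => H x (chartAt ℂ x y')) y :=
      ContinuousAt.comp (g := H x) hHy.1.continuousAt ((chartAt ℂ x).continuousAt hys)
    refine tendsto_nhds_unique_of_eventuallyEq (l := 𝓝[≠] y)
      (hcy.tendsto.mono_left nhdsWithin_le_nhds)
      (hcx.tendsto.mono_left nhdsWithin_le_nhds) ?_
    filter_upwards [hy.filter_mono nhdsWithin_le_nhds, (hE y).filter_mono nhdsWithin_le_nhds,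
      hU' y] with y' hx hy hyU
    rw [← hx hyU, ← hy hyU]
  refine ⟨v, fun x => ?_, fun x hx => (hE x).self_of_nhds hx⟩
  refine (harmonicAt_congr_nhds ?_).2 (hH x)
  filter_upwards [(tendsto_chartAt_symm x).eventually (hv x),
    (chartAt ℂ x).eventually_right_inverse (mem_chart_target ℂ x)] with w hw hw'
  rw [Function.comp_apply, hw, hw']

end Harmonic

/-! ### The Laplacian in one of two complex variables -/

section Laplacian

open Filter Topology InnerProductSpace Laplacian

theorem delbar_apply {V : Type*} (f : (V → ℂ) → ℂ) (z v : V → ℂ) :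
    delbar f z v = 1 / 2 * (fderiv ℝ f z v + Complex.I * fderiv ℝ f z (mulI v)) := rfl

theorem fderiv_del_apply {V : Type*} [Fintype V] {f : (V → ℂ) → ℂ} {z : V → ℂ}
    (hf : ContDiffAt ℝ 2 f z) (v w : V → ℂ) :
    fderiv ℝ (fun z' => del f z' v) z w = 1 / 2 * (fderiv ℝ (fderiv ℝ f) z w v -
      Complex.I * fderiv ℝ (fderiv ℝ f) z w (mulI v)) := by
  have hd : HasFDerivAt (fderiv ℝ f) (fderiv ℝ (fderiv ℝ f) z) z :=
    ((hf.fderiv_right (m := 1) le_rfl).differentiableAt one_ne_zero).hasFDerivAt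
  have hev (e : V → ℂ) :
      HasFDerivAt (fun z' => fderiv ℝ f z' e) ((fderiv ℝ (fderiv ℝ f) z).flip e) z := by
    simpa using hd.clm_apply (hasFDerivAt_const e z)
  exact congrArg (· w) ((((hev v).sub ((hev (mulI v)).const_mul Complex.I)).const_mul
    (1 / 2 : ℂ)).fderiv)

theorem delbar_del_apply_self {V : Type*} [Fintype V] {f : (V → ℂ) → ℂ} {z : V → ℂ}
    (hf : ContDiffAt ℝ 2 f z) (v : V → ℂ) :
    delbar (fun z' => del f z' v) z v = 1 / 4 * (fderiv ℝ (fderiv ℝ f) z v v +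
      fderiv ℝ (fderiv ℝ f) z (mulI v) (mulI v)) := by
  have hsymm : fderiv ℝ (fderiv ℝ f) z (mulI v) v = fderiv ℝ (fderiv ℝ f) z v (mulI v) :=
    (hf.isSymmSndFDerivAt (by simp)).eq _ _
  rw [delbar_apply, fderiv_del_apply hf, fderiv_del_apply hf, hsymm]
  linear_combination (-1 / 4 : ℂ) *
    fderiv ℝ (fderiv ℝ f) z (mulI v) (mulI v) * Complex.I_mul_I

theorem iteratedFDeriv_two_comp_add_clm {E E' F : Type*} [NormedAddCommGroup E] [NormedSpace ℝ E]
    [NormedAddCommGroup E'] [NormedSpace ℝ E'] [NormedAddCommGroup F] [NormedSpace ℝ F]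
    {f : E → F} (a : E) (A : E' →L[ℝ] E) {w : E'} (hf : ContDiffAt ℝ 2 f (a + A w)) (v v' : E') :
    iteratedFDeriv ℝ 2 (fun w' => f (a + A w')) w ![v, v'] =
      fderiv ℝ (fderiv ℝ f) (a + A w) (A v) (A v') := by
  have hA (w' : E') : HasFDerivAt (fun w'' => a + A w'') A w' := A.hasFDerivAt.const_add a
  have hfst : ∀ᶠ w' in 𝓝 w, fderiv ℝ (fun w'' => f (a + A w'')) w' =
      (fderiv ℝ f (a + A w')).comp A := by
    filter_upwards [(hA w).continuousAt.eventually (hf.eventually (by simp))] with w' hw'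
    exact ((hw'.differentiableAt two_ne_zero).hasFDerivAt.comp w' (hA w')).fderiv
  have hd : HasFDerivAt (fderiv ℝ f) (fderiv ℝ (fderiv ℝ f) (a + A w)) (a + A w) :=
    ((hf.fderiv_right (m := 1) le_rfl).differentiableAt one_ne_zero).hasFDerivAt
  have hsnd := ((hd.comp w (hA w)).clm_comp (hasFDerivAt_const A w)).fderiv
  simp only [Function.comp_def] at hsnd
  rw [iteratedFDeriv_two_apply, EventuallyEq.fderiv_eq hfst, hsnd]
  simp

theorem dzbar_dz_eq_laplacian (j : Fin 2) {f : (Fin 2 → ℂ) → ℂ} {z : Fin 2 → ℂ}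
    (hf : ContDiffAt ℝ 2 f z) :
    dzbar j (dz j f) z = 1 / 4 * Δ (fun w => f (Function.update z j w)) (z j) := by
  have hI : mulI (Pi.single j 1 : Fin 2 → ℂ) = Pi.single j Complex.I := by
    ext k
    simp [mulI, Pi.single_apply]
  let A := ContinuousLinearMap.single ℝ (fun _ : Fin 2 => ℂ) j
  have hA (w : ℂ) : Function.update z j w = Function.update z j 0 + A w := by
    ext k
    rcases eq_or_ne k j with rfl | h <;> simp [A, *]
  have hz : Function.update z j 0 + A (z j) = z := by rw [← hA, Function.update_eq_self]
  have hsnd (v v' : ℂ) : iteratedFDeriv ℝ 2 (fun w => f (Function.update z j w)) (z j) ![v, v'] =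
      fderiv ℝ (fderiv ℝ f) z (Pi.single j v) (Pi.single j v') := by
    rw [funext fun w => congrArg f (hA w), iteratedFDeriv_two_comp_add_clm _ A (hz.symm ▸ hf), hz]
    rfl
  rw [laplacian_eq_iteratedFDeriv_complexPlane]
  simp only [hsnd, ← hI]
  exact delbar_del_apply_self hf _

theorem laplacian_of_dzbar_dz {j : Fin 2} {f : (Fin 2 → ℂ) → ℂ} {z : Fin 2 → ℂ} {u : ℂ → ℝ}
    {r : ℝ} (hf : ContDiffAt ℝ 2 f z) (hu : ∀ w, f (Function.update z j w) = u w)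
    (hr : dzbar j (dz j f) z = r) : ContDiffAt ℝ 2 u (z j) ∧ Δ u (z j) = 4 * r := by
  have hslice : ContDiffAt ℝ 2 (fun w => f (Function.update z j w)) (z j) :=
    ContDiffAt.comp (g := f) (z j) (by simpa using hf) (contDiff_update 2 z j).contDiffAt
  have hu' : u = Complex.reCLM ∘ fun w => f (Function.update z j w) :=
    funext fun w => by simp [hu]
  have hc : ContDiffAt ℝ 2 u (z j) := by
    rw [hu']
    exact Complex.reCLM.contDiff.contDiffAt.comp (z j) hslice
  have hΔ : Δ (fun w => (u w : ℂ)) (z j) = (Δ u (z j) : ℝ) :=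
    hc.laplacian_CLM_comp_left (l := Complex.ofRealCLM)
  rw [dzbar_dz_eq_laplacian j hf, funext hu, hΔ] at hr
  refine ⟨hc, ?_⟩
  have hr' : 1 / 4 * Δ u (z j) = r := by
    apply Complex.ofReal_injective
    push_cast
    exact hr
  linarith

end Laplacian

/-! ### Symmetry of the Green function -/

section GreenSymmetry

open Filter Topology InnerProductSpace Laplacian

theorem contDiffAt_transition {X : Type*} [TopologicalSpace X] [ChartedSpace ℂ X] {n : ℕ∞ω}
    [IsManifold 𝓘(ℂ, ℂ) n X] (e e' : Chart X) {z : ℂ} (hz : z ∈ e.1.target)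
    (hz' : e.1.symm z ∈ e'.1.source) : ContDiffAt ℂ n (transition e e') z := by
  have hmem : e.1.symm.trans e'.1 ∈ contDiffGroupoid n 𝓘(ℂ, ℂ) :=
    StructureGroupoid.compatible _ e.2 e'.2
  have hsmooth := contMDiffOn_iff_contDiffOn.1 (contMDiffOn_of_mem_contDiffGroupoid hmem)
  refine hsmooth.contDiffAt ((e.1.symm.trans e'.1).open_source.mem_nhds ?_)
  simp [hz, hz']

variable {X : Type*} [TopologicalSpace X] [ChartedSpace ℂ X]
  [CompactSpace X] [MeasurableSpace X] [BorelSpace X]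

/-- The points of positive mass of an admissible current: none for a volume form, and `a` for
`δ_a`. -/
def AdmissibleCurrent.atoms : AdmissibleCurrent X → Set X
  | .vol _ => ∅
  | .delta a => {a}

namespace AdmissibleCurrent

theorem finite_atoms (μ : AdmissibleCurrent X) : μ.atoms.Finite := by
  cases μ with
  | vol m => exact Set.finite_empty
  | delta a => exact Set.finite_singleton a

theorem mem_divisor {μ : AdmissibleCurrent X} {x y : X} :
    (x, y) ∈ μ.divisor ↔ x = y ∨ x ∈ μ.atoms ∨ y ∈ μ.atoms := by
  cases μ with
  | vol m => simp [divisor, atoms]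
  | delta a => rfl

theorem swap_mem_divisor {μ : AdmissibleCurrent X} {x y : X} :
    (y, x) ∈ μ.divisor ↔ (x, y) ∈ μ.divisor := by
  rw [mem_divisor, mem_divisor, eq_comm, or_comm (a := y ∈ μ.atoms)]

theorem isClosed_divisor [T2Space X] (μ : AdmissibleCurrent X) : IsClosed μ.divisor := by
  cases μ with
  | vol m => exact isClosed_diagonal
  | delta a =>
    exact isClosed_diagonal.union ((isClosed_eq continuous_fst continuous_const).union
      (isClosed_eq continuous_snd continuous_const))

theorem compl_divisor_slice_mem_codiscrete [T1Space X] {μ : AdmissibleCurrent X} {x : X}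
    (hx : x ∉ μ.atoms) : {y | (x, y) ∉ μ.divisor} ∈ codiscrete X := by
  have hslice : {y | (x, y) ∉ μ.divisor} = (insert x μ.atoms)ᶜ := by
    ext y
    simp [mem_divisor, hx, eq_comm]
  rw [hslice]
  exact (μ.finite_atoms.insert x).compl_mem_codiscrete

theorem logSing_eq_zero {μ : AdmissibleCurrent X} {x₀ y₀ : X} (h : (x₀, y₀) ∉ μ.divisor)
    (x y : X) : μ.logSing x₀ y₀ x y = 0 := by
  cases μ with
  | vol m =>
    have hne : x₀ ≠ y₀ := h
    simp [logSing, hne]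
  | delta a =>
    have hne : x₀ ≠ y₀ ∧ x₀ ≠ a ∧ y₀ ≠ a := by simpa [divisor] using h
    simp [logSing, hne]

theorem logSing_swap (μ : AdmissibleCurrent X) (x₀ y₀ x y : X) :
    μ.logSing y₀ x₀ y x = μ.logSing x₀ y₀ x y := by
  rcases eq_or_ne x₀ y₀ with rfl | hne
  · cases μ <;> simp [logSing, norm_sub_rev, add_comm]
  · cases μ <;> simp [logSing, hne, hne.symm, add_comm]

end AdmissibleCurrent

namespace IsGreenFunction

variable {μ : AdmissibleCurrent X} {g g' : ℕ} {α : Fin g → holForms X} {α' : Fin g' → holForms X}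
  {G G' : X → X → ℝ}

theorem swap (hG : IsGreenFunction μ α G) : IsGreenFunction μ α fun x y => G y x where
  eq_zero p hp := hG.eq_zero p.swap (AdmissibleCurrent.swap_mem_divisor.2 hp)
  local_form x₀ y₀ := by
    obtain ⟨h, hh, hE⟩ := hG.local_form y₀ x₀
    refine ⟨h ∘ Prod.swap, hh.comp (chartAt ℂ x₀ x₀, chartAt ℂ y₀ y₀)
      (contDiff_snd.prodMk contDiff_fst).contDiffAt, ?_⟩
    filter_upwards [(continuous_swap.tendsto (x₀, y₀)).eventually hE] with p hp hd
    rw [← μ.logSing_swap]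
    exact hp (mt AdmissibleCurrent.swap_mem_divisor.1 hd)
  equation c z hz hd := by
    let φ : Fin 2 ≃ Fin 2 := Equiv.swap 0 1
    have hφ0 : φ 0 = 1 := Equiv.swap_apply_left 0 1
    have hφ1 : φ 1 = 0 := Equiv.swap_apply_right 0 1
    have hφ (j : Fin 2) : (Pi.single j 1 : Fin 2 → ℂ) ∘ φ = Pi.single (φ j) 1 := by
      funext i
      fin_cases j <;> fin_cases i <;> simp [φ]
    have hdz (f : (Fin 2 → ℂ) → ℂ) (j : Fin 2) :
        dz j (fun y => f (y ∘ φ)) = fun y => dz (φ j) f (y ∘ φ) := by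
      funext y
      rw [dz, del_comp_reindex, dz, ← hφ]
      rfl
    have hdzbar (f : (Fin 2 → ℂ) → ℂ) (j : Fin 2) :
        dzbar j (fun y => f (y ∘ φ)) = fun y => dzbar (φ j) f (y ∘ φ) := by
      funext y
      rw [dzbar, delbar_comp_reindex, dzbar, ← hφ]
      rfl
    have hrep : localRep (fun x : Fin 2 → X => G (x 1) (x 0)) c =
        fun y => localRep (fun x : Fin 2 → X => G (x 0) (x 1)) (c ∘ φ) (y ∘ φ) := by
      funext y
      simp [localRep, hφ0, hφ1]
    obtain ⟨h0, h1, h10, h01⟩ := hG.equation (c ∘ φ) (z ∘ φ) (fun j => hz (φ j))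
      (by simpa [hφ0, hφ1, AdmissibleCurrent.swap_mem_divisor] using hd)
    simp only [hrep, hdz, hdzbar, hφ0, hφ1, Function.comp_apply] at h0 h1 h10 h01 ⊢
    exact ⟨h1, h0, h01, h10⟩

theorem exists_contDiffAt_sub (hG : IsGreenFunction μ α G) (hG' : IsGreenFunction μ α' G')
    (x y₀ : X) :
    ∃ H : ℂ → ℝ, ContDiffAt ℝ 2 H (chartAt ℂ y₀ y₀) ∧
      ∀ᶠ y in 𝓝 y₀, (x, y) ∉ μ.divisor → G x y - G' x y = H (chartAt ℂ y₀ y) := by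
  obtain ⟨h, hh, hE⟩ := hG.local_form x y₀
  obtain ⟨h', hh', hE'⟩ := hG'.local_form x y₀
  have hpair : ContDiffAt ℝ 2 (fun w : ℂ => (chartAt ℂ x x, w)) (chartAt ℂ y₀ y₀) :=
    contDiffAt_const.prodMk contDiffAt_id
  have h2 : (2 : ℕ∞ω) ≤ ∞ := WithTop.coe_le_coe.2 le_top
  refine ⟨fun w => h (chartAt ℂ x x, w) - h' (chartAt ℂ x x, w),
    (ContDiffAt.comp (g := h) _ (hh.of_le h2) hpair).sub
      (ContDiffAt.comp (g := h') _ (hh'.of_le h2) hpair), ?_⟩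
  have hslice : Tendsto (fun y => (x, y)) (𝓝 y₀) (𝓝 (x, y₀)) :=
    (Continuous.prodMk_right x).tendsto y₀
  filter_upwards [hslice.eventually hE, hslice.eventually hE'] with y hy hy' hd
  rw [hy hd, hy' hd, add_sub_add_left_eq_sub]

variable [T2Space X] [IsManifold 𝓘(ℂ, ℂ) ω X]

theorem contDiffAt_localRep (hG : IsGreenFunction μ α G) {c : Fin 2 → Chart X} {z : Fin 2 → ℂ}
    (hz : ∀ j, z j ∈ (c j).1.target)
    (hd : ((c 0).1.symm (z 0), (c 1).1.symm (z 1)) ∉ μ.divisor) :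
    ContDiffAt ℝ 2 (localRep (fun x : Fin 2 → X => G (x 0) (x 1)) c) z := by
  let x (j : Fin 2) : X := (c j).1.symm (z j)
  let e (j : Fin 2) : Chart X := ⟨chartAt ℂ (x j), chart_mem_atlas ℂ (x j)⟩
  obtain ⟨h, hh, hE⟩ := hG.local_form (x 0) (x 1)
  have htrans (j : Fin 2) : ContDiffAt ℝ 2 (fun w : Fin 2 → ℂ => transition (c j) (e j) (w j)) z :=
    ContDiffAt.comp (g := transition (c j) (e j)) (f := fun w : Fin 2 → ℂ => w j) z
      (((contDiffAt_transition (n := ω) (c j) (e j) (hz j)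
        (mem_chart_source ℂ (x j))).restrict_scalars ℝ).of_le le_top)
      (contDiff_apply ℝ ℂ j).contDiffAt
  have hsmooth : ContDiffAt ℝ 2
      (fun w : Fin 2 → ℂ => h (transition (c 0) (e 0) (w 0), transition (c 1) (e 1) (w 1))) z :=
    ContDiffAt.comp (g := h) z (hh.of_le (WithTop.coe_le_coe.2 le_top))
      ((htrans 0).prodMk (htrans 1))
  refine (Complex.ofRealCLM.contDiff.contDiffAt.comp z hsmooth).congr_of_eventuallyEq ?_
  have hsymm (j : Fin 2) : Tendsto (fun w : Fin 2 → ℂ => (c j).1.symm (w j)) (𝓝 z) (𝓝 (x j)) :=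
    ((c j).1.continuousAt_symm (hz j)).tendsto.comp ((continuous_apply j).tendsto z)
  have hpair := (hsymm 0).prodMk_nhds (hsymm 1)
  filter_upwards [hpair.eventually hE,
    hpair.eventually (μ.isClosed_divisor.isOpen_compl.eventually_mem hd)] with w hw hwd
  rw [localRep, hw hwd, AdmissibleCurrent.logSing_eq_zero hd, zero_add]
  rfl

theorem laplacian_slice (hG : IsGreenFunction μ α G) {x : X} {e : Chart X} {w : ℂ}
    (hw : w ∈ e.1.target) (hd : (x, e.1.symm w) ∉ μ.divisor) :
    ContDiffAt ℝ 2 (fun w => G x (e.1.symm w)) w ∧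
      Δ (fun w => G x (e.1.symm w)) w = 4 * (-Real.pi * μ.dens e w) := by
  have hx : (chartAt ℂ x).symm (chartAt ℂ x x) = x := (chartAt ℂ x).left_inv (mem_chart_source ℂ x)
  let c : Fin 2 → Chart X := ![⟨chartAt ℂ x, chart_mem_atlas ℂ x⟩, e]
  let z : Fin 2 → ℂ := ![chartAt ℂ x x, w]
  have hz : ∀ j, z j ∈ (c j).1.target := by simp [Fin.forall_fin_two, z, c, hw]
  have hcz : ((c 0).1.symm (z 0), (c 1).1.symm (z 1)) ∉ μ.divisor := by simpa [z, c, hx] using hd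
  refine laplacian_of_dzbar_dz (j := 1) (hG.contDiffAt_localRep hz hcz) (fun w => ?_) ?_
  · simp [localRep, z, c, hx]
  · exact_mod_cast (hG.equation c z hz hcz).2.1

theorem laplacian_eq_zero_of_eventuallyEq_sub (hG : IsGreenFunction μ α G)
    (hG' : IsGreenFunction μ α' G') {x : X} {e : Chart X} {w : ℂ} (hw : w ∈ e.1.target)
    (hd : (x, e.1.symm w) ∉ μ.divisor) {H : ℂ → ℝ}
    (hH : H =ᶠ[𝓝 w] fun w => G x (e.1.symm w) - G' x (e.1.symm w)) : Δ H w = 0 := by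
  obtain ⟨hsmooth, hΔ⟩ := hG.laplacian_slice hw hd
  obtain ⟨hsmooth', hΔ'⟩ := hG'.laplacian_slice hw hd
  have hsub := hsmooth.laplacian_sub hsmooth'
  rw [hΔ, hΔ', sub_self] at hsub
  exact (laplacian_congr_nhds hH).self_of_nhds.trans hsub

theorem exists_harmonicAt_sub (hG : IsGreenFunction μ α G) (hG' : IsGreenFunction μ α' G') {x : X}
    (hx : x ∉ μ.atoms) (y₀ : X) :
    ∃ H : ℂ → ℝ, HarmonicAt H (chartAt ℂ y₀ y₀) ∧
      ∀ᶠ y in 𝓝 y₀, (x, y) ∉ μ.divisor → G x y - G' x y = H (chartAt ℂ y₀ y) := by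
  let e : Chart X := ⟨chartAt ℂ y₀, chart_mem_atlas ℂ y₀⟩
  obtain ⟨H, hH, hsub⟩ := hG.exists_contDiffAt_sub hG' x y₀
  refine ⟨H, harmonicAt_of_eventually_laplacian_eq_zero hH ?_, hsub⟩
  have hy₀ : chartAt ℂ y₀ y₀ ∈ (chartAt ℂ y₀).target := mem_chart_target ℂ y₀
  have hsymm := tendsto_chartAt_symm y₀
  have hgeneric : ∀ᶠ y in 𝓝[≠] y₀, (x, y) ∉ μ.divisor :=
    eventually_iff.2 (by simpa using mem_codiscrete.1 (μ.compl_divisor_slice_mem_codiscrete hx) y₀)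
  rw [eventually_nhdsWithin_iff] at hgeneric ⊢
  filter_upwards [hsymm.eventually hsub.eventually_nhds, hsymm.eventually hgeneric,
    (chartAt ℂ y₀).open_target.eventually_mem hy₀] with w hw hwd hwt hne
  have hd := hwd fun h => hne (by rw [← (chartAt ℂ y₀).right_inv hwt, h]; rfl)
  have hnear := ((chartAt ℂ y₀).continuousAt_symm hwt).eventually
    (hw.and ((Continuous.prodMk_right x).continuousAt.eventually
      (μ.isClosed_divisor.isOpen_compl.eventually_mem hd)))
  refine hG.laplacian_eq_zero_of_eventuallyEq_sub hG' (e := e) hwt hd ?_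
  filter_upwards [hnear, (chartAt ℂ y₀).open_target.eventually_mem hwt] with w' hw' hwt'
  rw [hw'.1 hw'.2, (chartAt ℂ y₀).right_inv hwt']

theorem exists_sub_eq [ConnectedSpace X] (hG : IsGreenFunction μ α G)
    (hG' : IsGreenFunction μ α' G') {x : X} (hx : x ∉ μ.atoms) :
    ∃ C : ℝ, ∀ y, (x, y) ∉ μ.divisor → G x y - G' x y = C := by
  obtain ⟨v, hv, hGv⟩ := exists_isHarmonic_eqOn_of_mem_codiscrete
    (AdmissibleCurrent.compl_divisor_slice_mem_codiscrete hx) (hG.exists_harmonicAt_sub hG' hx)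
  exact ⟨v x, fun y hy => (hGv hy).trans (hv.eq y x)⟩

theorem symm [ConnectedSpace X] (hG : IsGreenFunction μ α G) (x y : X) : G x y = G y x := by
  by_cases hxy : (x, y) ∈ μ.divisor
  · rw [hG.eq_zero _ hxy, hG.eq_zero _ (AdmissibleCurrent.swap_mem_divisor.2 hxy)]
  obtain ⟨z, -, hz⟩ := (infinite_of_mem_nhds x Filter.univ_mem).exists_notMem_finite
    ((μ.finite_atoms.insert x).insert y)
  simp only [AdmissibleCurrent.mem_divisor, not_or] at hxy
  simp only [Set.mem_insert_iff, not_or] at hz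
  obtain ⟨Cx, hCx⟩ := hG.exists_sub_eq hG.swap hxy.2.1
  obtain ⟨Cy, hCy⟩ := hG.exists_sub_eq hG.swap hxy.2.2
  obtain ⟨Cz, hCz⟩ := hG.exists_sub_eq hG.swap hz.2.2
  simp only [AdmissibleCurrent.mem_divisor, not_or] at hCx hCy hCz
  -- With `D p q = G p q - G q p` equal to a constant `C p` for generic `q`, antisymmetry gives
  -- `C x = -C y`, and likewise for `(x, z)` and `(y, z)`; so all three constants vanish.
  have hxy' := hCx y hxy
  have hxz := hCx z ⟨Ne.symm hz.2.1, hxy.2.1, hz.2.2⟩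
  have hyx := hCy x ⟨Ne.symm hxy.1, hxy.2.2, hxy.2.1⟩
  have hyz := hCy z ⟨Ne.symm hz.1, hxy.2.2, hz.2.2⟩
  have hzx := hCz x ⟨hz.2.1, hz.2.2, hxy.2.1⟩
  have hzy := hCz y ⟨hz.1, hz.2.2, hxy.2.2⟩
  linarith

end IsGreenFunction

end GreenSymmetry

/-! ### The Hodge correlator map -/

section TensorAlgebra

theorem tensorAlgebra_basis_apply {R W κ : Type*} [CommRing R] [AddCommGroup W] [Module R W]
    (b : Module.Basis κ R W) (w : FreeMonoid κ) :
    b.tensorAlgebra w = ((FreeMonoid.toList w).map fun k => TensorAlgebra.ι R (b k)).prod := by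
  have h : FreeAlgebra.basisFreeMonoid R κ w = FreeMonoid.lift (FreeAlgebra.ι R) w := by
    simp [FreeAlgebra.basisFreeMonoid, FreeAlgebra.equivMonoidAlgebraFreeMonoid]
  rw [Module.Basis.tensorAlgebra, Module.Basis.map_apply, h]
  simp [FreeMonoid.lift_apply, Function.comp_def, map_list_prod]

theorem permuteTail_eq_comp {W : Type*} {n : ℕ} (v : Fin (n + 1) → W) (σ : Equiv.Perm (Fin n)) :
    permuteTail v σ = v ∘ Equiv.Perm.decomposeFin.symm (0, σ) := by
  funext i
  cases i using Fin.cases <;> simp [permuteTail]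

theorem existsUnique_comp_mkQ_eq {R M N : Type*} [Ring R] [AddCommGroup M] [Module R M]
    [AddCommGroup N] [Module R N] {p : Submodule R M} {f : M →ₗ[R] N} (h : p ≤ LinearMap.ker f) :
    ∃! g : M ⧸ p →ₗ[R] N, g ∘ₗ p.mkQ = f :=
  ⟨p.liftQ f h, p.liftQ_mkQ f h, fun _ hg =>
    Submodule.linearMap_qext p (hg.trans (p.liftQ_mkQ f h).symm)⟩

variable {W N : Type*} [AddCommGroup W] [Module ℂ W] [AddCommGroup N] [Module ℂ N]

theorem commutators_le_ker {f : TensorAlgebra ℂ W →ₗ[ℂ] N} (hf : ∀ x y, f (x * y) = f (y * x)) :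
    commutators W ≤ LinearMap.ker (f ∘ₗ (augIdeal W).subtype) := by
  refine Submodule.span_le.2 ?_
  rintro c ⟨x, y, hc⟩
  rw [SetLike.mem_coe, LinearMap.mem_ker, LinearMap.comp_apply, Submodule.subtype_apply, hc,
    map_sub, hf, sub_self]

theorem shuffleRelations_le_ker {f : CycEnv W →ₗ[ℂ] N}
    (hf : ∀ p q : ℕ, 1 ≤ p → 1 ≤ q → ∀ v : Fin (p + q + 1) → W,
      ∑ σ ∈ shuffles p q, f (cycWord (permuteTail v σ)) = 0) :
    shuffleRelations W ≤ LinearMap.ker f := by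
  refine Submodule.span_le.2 ?_
  rintro c ⟨p, q, hp, hq, v, rfl⟩
  rw [SetLike.mem_coe, LinearMap.mem_ker, map_sum, hf p q hp hq]

end TensorAlgebra

section Correlator

variable {X : Type*} [TopologicalSpace X] [ChartedSpace ℂ X]
  [CompactSpace X] [MeasurableSpace X] [BorelSpace X] {S : Finset X} (G : X → X → ℝ)

theorem sum_shuffles_corWord {p q : ℕ} (hp : 1 ≤ p) (hq : 1 ≤ q)
    (l : Fin (p + q + 1) → Letter S) :
    ∑ σ ∈ shuffles p q, corWord G (List.ofFn (permuteTail l σ)) = 0 := by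
  have hcons (σ : Equiv.Perm (Fin (p + q))) : corWord G (List.ofFn (permuteTail l σ)) =
      ∑ T ∈ PlaneTree.withEnds (List.ofFn ((fun i => l i.succ) ∘ σ)), treeIntegral G (l 0) T := by
    rw [List.ofFn_succ]
    exact PlaneTree.finsum_ends_eq (treeIntegral G (l 0)) _
  simp only [hcons]
  exact sum_shuffles_withEnds (fun T T' h => h.treeIntegral_eq G (l 0)) hp hq fun i => l i.succ

variable {K : Type*} (b : Module.Basis K ℂ (OneForms X))

/-- The basis of `V^∨` made up of the points of `S` and the one-forms of a basis `b`. -/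
def vdualBasis (S : Finset X) : Module.Basis (S ⊕ K) ℂ (VDual S) :=
  Finsupp.basisSingleOne.prod b

theorem cor_prod_vdualBasis (w : List (S ⊕ K)) :
    cor G b (w.map fun k => TensorAlgebra.ι ℂ (vdualBasis b S k)).prod =
      corWord G (w.map (Sum.map id b)) := by
  have h := (vdualBasis b S).tensorAlgebra.constr_basis ℂ
    (fun w : FreeMonoid (S ⊕ K) => corWord G ((FreeMonoid.toList w).map (Sum.map id b)))
    (FreeMonoid.ofList w)
  rwa [tensorAlgebra_basis_apply] at h

theorem sum_shuffles_cor {p q : ℕ} (hp : 1 ≤ p) (hq : 1 ≤ q) (v : Fin (p + q + 1) → VDual S) :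
    ∑ σ ∈ shuffles p q, cor G b (tensorWord (permuteTail v σ)).1 = 0 := by
  let M : MultilinearMap ℂ (fun _ : Fin (p + q + 1) => VDual S) ℂ :=
    ∑ σ ∈ shuffles p q, (cor G b).compMultilinearMap
      ((TensorAlgebra.tprod ℂ (VDual S) (p + q + 1)).domDomCongr
        (Equiv.Perm.decomposeFin.symm (0, σ)))
  have hM (v) : M v = ∑ σ ∈ shuffles p q, cor G b (tensorWord (permuteTail v σ)).1 := by
    simp [M, sum_apply, permuteTail_eq_comp, tensorWord]
  suffices h : M = 0 by rw [← hM, h, zero_apply]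
  refine Module.Basis.ext_multilinear (fun _ => vdualBasis b S) fun k => ?_
  rw [hM, zero_apply, ← sum_shuffles_corWord G hp hq (Sum.map id b ∘ k)]
  refine Finset.sum_congr rfl fun σ _ => ?_
  have h := cor_prod_vdualBasis G b (List.ofFn (permuteTail k σ))
  simp only [permuteTail_eq_comp, List.map_ofFn] at h ⊢
  exact h

variable {G}

theorem cor_mul_comm (hG : ∀ x y, G x y = G y x) (x y : TensorAlgebra ℂ (VDual S)) :
    cor G b (x * y) = cor G b (y * x) := by
  have h : (LinearMap.mul ℂ (TensorAlgebra ℂ (VDual S))).compr₂ (cor G b) =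
      (LinearMap.mul ℂ (TensorAlgebra ℂ (VDual S))).flip.compr₂ (cor G b) := by
    refine LinearMap.ext_basis (vdualBasis b S).tensorAlgebra (vdualBasis b S).tensorAlgebra
      fun w w' => ?_
    simp only [LinearMap.compr₂_apply, LinearMap.mul_apply', LinearMap.flip_apply,
      tensorAlgebra_basis_apply]
    rw [← List.prod_append, ← List.prod_append, ← List.map_append, ← List.map_append,
      cor_prod_vdualBasis, cor_prod_vdualBasis, List.map_append, List.map_append,
      corWord_append_comm hG]
  exact LinearMap.congr_fun₂ h x y

end Correlator

end HodgeCorrelator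

end

open HodgeCorrelator in
theorem proposition7p3p06p4_general
    {X : Type*} [TopologicalSpace X] [CompactSpace X] [ChartedSpace ℂ X]
    [MeasurableSpace X] [BorelSpace X] (S : Finset X)
    {G : X → X → ℝ} (hG : ∀ x y, G x y = G y x)
    {K : Type*} (b : Module.Basis K ℂ (OneForms X)) :
    (∀ p q : ℕ, 1 ≤ p → 1 ≤ q → ∀ l : Fin (p + q + 1) → Letter S,
      ∑ σ ∈ shuffles p q, corWord G (List.ofFn (permuteTail l σ)) = 0) ∧
    ∃! Cor : CycEnv (VDual S) →ₗ[ℂ] ℂ,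
      (∀ w : augIdeal (VDual S), Cor ((commutators (VDual S)).mkQ w) = cor G b w.1) ∧
      (∀ p q : ℕ, 1 ≤ p → 1 ≤ q → ∀ v : Fin (p + q + 1) → VDual S,
        ∑ σ ∈ shuffles p q, Cor (cycWord (permuteTail v σ)) = 0) ∧
      ∃! CorLie : CLie (VDual S) →ₗ[ℂ] ℂ,
        CorLie ∘ₗ (shuffleRelations (VDual S)).mkQ = Cor := by
  refine ⟨fun p q hp hq l => sum_shuffles_corWord G hp hq l, ?_⟩
  obtain ⟨Cor, hCor, hunique⟩ := existsUnique_comp_mkQ_eq (commutators_le_ker (cor_mul_comm b hG))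
  have hword (w : augIdeal (VDual S)) : Cor ((commutators (VDual S)).mkQ w) = cor G b w.1 :=
    LinearMap.congr_fun hCor w
  have hshuffle (p q : ℕ) (hp : 1 ≤ p) (hq : 1 ≤ q) (v : Fin (p + q + 1) → VDual S) :
      ∑ σ ∈ shuffles p q, Cor (cycWord (permuteTail v σ)) = 0 := by
    simpa only [cycWord, hword] using sum_shuffles_cor G b hp hq v
  exact ⟨Cor, ⟨hword, hshuffle, existsUnique_comp_mkQ_eq (shuffleRelations_le_ker hshuffle)⟩,
    fun C hC => hunique C (LinearMap.ext hC.1)⟩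

open HodgeCorrelator in
theorem proposition7p3p06p4
    {X : Type*} [TopologicalSpace X] [T2Space X] [CompactSpace X] [ConnectedSpace X]
    [ChartedSpace ℂ X] [IsManifold 𝓘(ℂ, ℂ) ω X] [MeasurableSpace X] [BorelSpace X]
    (S : Finset X) (μ : AdmissibleCurrent X)
    {g : ℕ} (α : Module.Basis (Fin g) ℂ (holForms X)) (hα : IsOrthonormal α)
    (G : X → X → ℝ) (hG : IsGreenFunction μ α G)
    {K : Type*} (b : Module.Basis K ℂ (OneForms X)) :
    (∀ p q : ℕ, 1 ≤ p → 1 ≤ q → ∀ l : Fin (p + q + 1) → Letter S,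
      ∑ σ ∈ shuffles p q, corWord G (List.ofFn (permuteTail l σ)) = 0) ∧
    ∃! Cor : CycEnv (VDual S) →ₗ[ℂ] ℂ,
      (∀ w : augIdeal (VDual S), Cor ((commutators (VDual S)).mkQ w) = cor G b w.1) ∧
      (∀ p q : ℕ, 1 ≤ p → 1 ≤ q → ∀ v : Fin (p + q + 1) → VDual S,
        ∑ σ ∈ shuffles p q, Cor (cycWord (permuteTail v σ)) = 0) ∧
      ∃! CorLie : CLie (VDual S) →ₗ[ℂ] ℂ,
        CorLie ∘ₗ (shuffleRelations (VDual S)).mkQ = Cor :=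
  proposition7p3p06p4_general S hG.symm b
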